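/- Let relation names, variable names and data values be finite binary words. A conjunctive query is a rule $Q:\ ans(\mathbf u)\leftarrow r_1(\mathbf u_1)\wedge\cdots\wedge r_n(\mathbf u_n)$ with $n\ge 0$, where $\mathbf u,\mathbf u_1,\dots,\mathbf u_n$ are lists of variables and constants; $atoms(Q)$ is the set of its body atoms, and $var(Q)$, $var(A)$ and $var(R)$ are the sets of variables occurring in $Q$, in an atom $A$ and in a set $R$ of atoms. A database $\mathbf{DB}$ is a finite set of ground atoms together with a finite universe $U$ that contains all values occurring in them. The answer of $Q$ on $\mathbf{DB}$ is the relation consisting of all tuples $\mathbf u\theta$, where $\theta:var(Q)\to U$ is a substitution with $r_i(\mathbf u_i)\theta\in\mathbf{DB}$ for $1\le i\le n$. A hypertree decomposition of $Q$ is a finite rooted tree $T$ whose vertices $p$ carry labels $\chi(p)\subseteq var(Q)$ and $\lambda(p)\subseteq atoms(Q)$ such that (1) for each $A\in atoms(Q)$ there is a vertex $p$ with $var(A)\subseteq\chi(p)$; (2) for each $Y\in var(Q)$ the set $\{p : Y\in\chi(p)\}$ induces a connected (possibly empty) subtree of $T$; (3) $\chi(p)\subseteq var(\lambda(p))$ for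 each $p$; (4) $var(\lambda(p))\cap\chi(T_p)\subseteq\chi(p)$ for each $p$, where $T_p$ is the subtree of $T$ rooted at $p$ and $\chi(T_p)$ is the union of the labels $\chi(q)$ over the vertices $q$ of $T_p$. Its width is $\max_p|\lambda(p)|$, and the hypertree width $hw(Q)$ is the minimum width of a hypertree decomposition of $Q$. Theorem. For every fixed $k$ there are a deterministic Turing machine $M$ and a polynomial $p$ such that, for every conjunctive query $Q$ with $hw(Q)\le k$ and every database $\mathbf{DB}$, the machine $M$, given as input only (a string encoding of) $Q$ and $\mathbf{DB}$, and in particular no decomposition of $Q$, halts with (a string encoding of) a repetition-free list of the tuples of the answer of $Q$ on $\mathbf{DB}$ as its output, after at most $p(\|\text{input}\|+\|\text{output}\|)$ steps, where $\|\cdot\|$ is the length of the encoding. -/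

import Mathlib

open Computability (Γ')

namespace ConjQuery

/-! ### Databases and conjunctive queries -/

/-- Names of relations, names of variables and data values are finite binary words
(any countable supply of names and values can be written this way). -/
abbrev Word : Type := List Bool

/-- A term is a variable or a constant. -/
inductive Term : Type
  | var (x : Word)
  | const (c : Word)
  deriving DecidableEq

/-- The set of variables of a term: `{x}` for a variable `x`, empty for a constant. -/
def Term.vars : Term → Finset Word
  | .var x => {x}
  | .const _ => ∅

/-- The value of a term under a substitution `θ` of values for variables. -/
def Term.subst (θ : Word → Word) : Term → Word
  | .var x => θ x
  | .const c => c

/-- An atom `r(u)`: a relation name and a list of terms. -/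
structure Atom : Type where
  rel : Word
  args : List Term
  deriving DecidableEq

/-- `var(A)`, the set of variables occurring in the atom `A`. -/
def Atom.vars (A : Atom) : Finset Word :=
  A.args.toFinset.biUnion Term.vars

/-- `var(R)` for a finite set `R` of atoms. -/
def atomsVars (R : Finset Atom) : Finset Word :=
  R.biUnion Atom.vars

/-- A ground atom `r(a₁, …, aₘ)`. -/
structure Fact : Type where
  rel : Word
  args : List Word
  deriving DecidableEq

/-- `Aθ`, the ground atom obtained from `A` by substituting `θ X` for each variable `X`. -/
def Atom.subst (θ : Word → Word) (A : Atom) : Fact where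
  rel := A.rel
  args := A.args.map (Term.subst θ)

/-- A database, identified with a finite set of ground atoms, together with a finite universe
that contains all values occurring in them. Both finite sets are given by a listing, in any
order; only membership in the listings matters for the semantics. -/
structure Database : Type where
  facts : List Fact
  dom : List Word
  mem_dom : ∀ f ∈ facts, ∀ a ∈ f.args, a ∈ dom

/-- A conjunctive query `ans(u) ← r₁(u₁) ∧ ⋯ ∧ rₙ(uₙ)` with `n ≥ 0`. -/
structure Query : Type where
  head : List Term
  body : List Atom

/-- `atoms(Q)`, the set of atoms contained in the body of `Q`. -/
def Query.atoms (Q : Query) : Finset Atom :=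
  Q.body.toFinset

/-- `var(Q)`, the set of variables occurring in `Q`. -/
def Query.vars (Q : Query) : Finset Word :=
  Q.head.toFinset.biUnion Term.vars ∪ atomsVars Q.atoms

/-- The answer of `Q` on `D`: all tuples `uθ` such that the substitution `θ` maps `var(Q)` into
the universe of `D` and turns each body atom into a ground atom of `D`.
(The values of `θ` outside `var(Q)` play no role.) -/
def Query.answer (Q : Query) (D : Database) : Set (List Word) :=
  {t | ∃ θ : Word → Word, (∀ x ∈ Q.vars, θ x ∈ D.dom) ∧
    (∀ A ∈ Q.atoms, A.subst θ ∈ D.facts) ∧ t = Q.head.map (Term.subst θ)}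

/-! ### Hypertree decompositions -/

/-- A hypertree `⟨T, χ, λ⟩` for `Q`: a finite rooted tree with two labelings of its vertices,
by sets of variables and by sets of atoms of `Q`. -/
structure Hypertree (Q : Query) : Type 1 where
  V : Type
  fintypeV : Fintype V
  T : SimpleGraph V
  isTree : T.IsTree
  root : V
  chi : V → Finset Word
  lam : V → Finset Atom
  chi_subset : ∀ p, chi p ⊆ Q.vars
  lam_subset : ∀ p, lam p ⊆ Q.atoms

attribute [instance] Hypertree.fintypeV

namespace Hypertree

variable {Q : Query} (H : Hypertree Q)

/-- The vertices of the subtree `T_p` rooted at `p`: those `q` for which `p` lies on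
the path from the root to `q`. -/
def subtree (p : H.V) : Set H.V :=
  {q | ∀ w : H.T.Walk H.root q, w.IsPath → p ∈ w.support}

/-- The four conditions that make a hypertree a hypertree decomposition. -/
structure IsDecomposition : Prop where
  /-- Every atom is covered by the `χ`-label of some vertex. -/
  cover : ∀ A ∈ Q.atoms, ∃ p, A.vars ⊆ H.chi p
  /-- Connectedness condition. -/
  connected : ∀ Y ∈ Q.vars, (H.T.induce {p | Y ∈ H.chi p}).Preconnected
  /-- `χ(p) ⊆ var(λ(p))`. -/
  chi_subset_lam : ∀ p, H.chi p ⊆ atomsVars (H.lam p)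
  /-- `var(λ(p)) ∩ χ(T_p) ⊆ χ(p)`. -/
  descendant : ∀ p, ∀ q ∈ H.subtree p, atomsVars (H.lam p) ∩ H.chi q ⊆ H.chi p

/-- The width, `max_p |λ(p)|`. -/
def width : ℕ :=
  Finset.univ.sup fun p => (H.lam p).card

end Hypertree

/-- The hypertree width `hw(Q)`: the minimum width of a hypertree decomposition of `Q`. -/
noncomputable def Query.hypertreeWidth (Q : Query) : ℕ∞ :=
  ⨅ (H : Hypertree Q) (_ : H.IsDecomposition), (H.width : ℕ∞)

/-! ### Encoding of inputs and outputs as strings over a finite alphabet -/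

/-- `(s)`. -/
def enclose (s : List Γ') : List Γ' :=
  Γ'.bra :: (s ++ [Γ'.ket])

/-- The word `b₁ ⋯ bₘ` is written `(b₁ ⋯ bₘ)`. -/
def encodeWord (w : Word) : List Γ' :=
  enclose (w.map Γ'.bit)

/-- The list `x₁, …, xₘ` is written `(x₁ ⋯ xₘ)`. -/
def encodeList {α : Type} (f : α → List Γ') (l : List α) : List Γ' :=
  enclose (l.flatMap f)

/-- The word of a variable is marked by a leading `0`, that of a constant by a leading `1`. -/
def encodeTerm : Term → List Γ'
  | .var x => encodeWord (false :: x)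
  | .const c => encodeWord (true :: c)

def encodeAtom (A : Atom) : List Γ' :=
  enclose (encodeWord A.rel ++ encodeList encodeTerm A.args)

def encodeFact (f : Fact) : List Γ' :=
  enclose (encodeWord f.rel ++ encodeList encodeWord f.args)

def encodeQuery (Q : Query) : List Γ' :=
  enclose (encodeList encodeTerm Q.head ++ encodeList encodeAtom Q.body)

def encodeDatabase (D : Database) : List Γ' :=
  enclose (encodeList encodeFact D.facts ++ encodeList encodeWord D.dom)

/-- The input instance `(Q, D)`. -/
def encodeInstance (Q : Query) (D : Database) : List Γ' :=
  enclose (encodeQuery Q ++ encodeDatabase D)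

/-- A relation, given by a listing of its tuples. -/
def encodeRelation (L : List (List Word)) : List Γ' :=
  encodeList (encodeList encodeWord) L

/-! ### Deterministic Turing machines -/

/-- The (multi-stack) Turing machine `M`, started on the string `input`,
halts with the string `output` after at most `t` steps. -/
def OutputsWithin (M : Turing.TM2ComputableAux Γ' Γ') (input output : List Γ') (t : ℕ) : Prop :=
  Nonempty (Turing.TM2OutputsInTime M.tm (input.map M.inputAlphabet.symm)
    (some (output.map M.outputAlphabet.symm)) t)

end ConjQuery

namespace ConjQuery

/-! Put n = k + 1. For every choice of n relations among those of the body atoms and a trivial one,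
form the group of their joint bindings; for fixed n there are polynomially many. Delete bindings
that have no compatible partner in some group, until nothing changes, and accept if no group has
become empty. Bindings that follow a solution are never deleted, so the test accepts whenever a
solution exists (`consistent_of_solution`).

Conversely, suppose that the test accepts and that some decomposition has width at most k. Choose a
surviving binding in the group of λ(root), and pass along the edges of the tree, choosing at each
vertex p a survivor in the group of λ(p) that is compatible with the choice before. Each choice
binds all of χ(p), and by connectedness a variable receives the same value wherever it occurs in a
χ-label, so the choices glue to a solution (`exists_solution_of_consistent`). The decomposition
serves only this argument; the algorithm never sees one.

The answer is enumerated by binding the head terms one at a time and keeping the partial bindings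
that pass the test. As the test is exact, each of them extends to a solution (`mem_stage`), so no
stage has more members than the answer (`length_stage_le`), and all intermediate lists are
polynomial in input plus output.

For the machine model, programs on five stacks are translated into Turing machines, and data are
trees in bracket notation. Functions in `PolyTime` are closed under composition, pairing and folds
with bounded intermediate results, so the algorithm is assembled from such functions. The weight
that measures time may exceed the length of the input; in the end it includes the length of the
output. -/

/-! ### A structured language for stack machines -/

/-- The registers (stacks) of the machine: the accumulator, the save stack, and temporaries. -/
inductive Reg : Type
  | acc | save | tmp | cnt | aux
  deriving DecidableEq

instance : Fintype Reg where
  elems := {.acc, .save, .tmp, .cnt, .aux}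
  complete k := by cases k <;> simp

/-- A store assigns to each register its contents. -/
structure Store : Type where
  acc : List Γ'
  save : List Γ'
  tmp : List Γ'
  cnt : List Γ'
  aux : List Γ'

/-- The contents of a register. -/
def Store.get (s : Store) : Reg → List Γ'
  | .acc => s.acc
  | .save => s.save
  | .tmp => s.tmp
  | .cnt => s.cnt
  | .aux => s.aux

/-- The store obtained by changing the contents of a register. -/
def Store.set (s : Store) (k : Reg) (x : List Γ') : Store :=
  match k with
  | .acc => { s with acc := x }
  | .save => { s with save := x }
  | .tmp => { s with tmp := x }
  | .cnt => { s with cnt := x }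
  | .aux => { s with aux := x }

theorem Store.get_set (s : Store) (k : Reg) (x : List Γ') :
    (s.set k x).get = Function.update s.get k x := by
  funext j
  cases k <;> cases j <;> rfl

/-- Structured programs over stacks. The statement `case k f` pops the register `k` and continues
with `f v`, where `v` is the symbol popped (`none` if the stack was empty); the statement
`loop k quit f` repeatedly pops `k`, exits if `quit v` holds, and runs `f v` otherwise. -/
inductive Prog : Type
  | skip : Prog
  | push (k : Reg) (a : Γ') : Prog
  | seq (p q : Prog) : Prog
  | case (k : Reg) (f : Option Γ' → Prog) : Prog
  | loop (k : Reg) (quit : Option Γ' → Bool) (f : Option Γ' → Prog) : Prog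

infixr:60 " ;; " => Prog.seq

/-- `Exec p n s s'`: started in the store `s`, the program `p` ends in the store `s'` after at
most `n` steps. -/
inductive Exec : Prog → ℕ → Store → Store → Prop
  | skip {n s} : 1 ≤ n → Exec .skip n s s
  | push {k a n s} : 1 ≤ n → Exec (.push k a) n s (s.set k (a :: s.get k))
  | seq {p q m n r s s' s''} : Exec p m s s' → Exec q n s' s'' → m + n ≤ r →
      Exec (.seq p q) r s s''
  | case {k f n r s s'} : Exec (f (s.get k).head?) n (s.set k (s.get k).tail) s' →
      n + 1 ≤ r → Exec (.case k f) r s s'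
  | quit {k quit f r s} : quit (s.get k).head? = true → 1 ≤ r →
      Exec (.loop k quit f) r s (s.set k (s.get k).tail)
  | step {k quit f m n r s s' s''} : quit (s.get k).head? = false →
      Exec (f (s.get k).head?) m (s.set k (s.get k).tail) s' →
      Exec (.loop k quit f) n s' s'' → m + n + 1 ≤ r → Exec (.loop k quit f) r s s''

theorem Exec.mono {p : Prog} {m n : ℕ} {s s' : Store} (h : Exec p m s s') (hmn : m ≤ n) :
    Exec p n s s' := by
  cases h with
  | skip h => exact .skip (h.trans hmn)
  | push h => exact .push (h.trans hmn)
  | seq h₁ h₂ h => exact .seq h₁ h₂ (h.trans hmn)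
  | case h₁ h => exact .case h₁ (h.trans hmn)
  | quit h₁ h => exact .quit h₁ (h.trans hmn)
  | step h₁ h₂ h₃ h => exact .step h₁ h₂ h₃ (h.trans hmn)

/-! ### Translation of programs into machines -/

namespace Prog

/-- The control points of a program. -/
inductive Label : Prog → Type
  | skip : Label .skip
  | push {k a} : Label (.push k a)
  | left {p q} (l : Label p) : Label (.seq p q)
  | right {p q} (l : Label q) : Label (.seq p q)
  | case {k f} : Label (.case k f)
  | caseBody {k f} (v) (l : Label (f v)) : Label (.case k f)
  | loop {k quit f} : Label (.loop k quit f)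
  | loopBody {k quit f} (v) (l : Label (f v)) : Label (.loop k quit f)

/-- The control point at which a program starts. -/
def entry : (p : Prog) → Label p
  | skip => .skip
  | push _ _ => .push
  | seq p _ => .left (entry p)
  | case _ _ => .case
  | loop _ _ _ => .loop

theorem finite_label (p : Prog) : Finite (Label p) := by
  induction p with
  | skip => exact .of_surjective (fun _ : Unit => Label.skip) (by rintro ⟨⟩; exact ⟨(), rfl⟩)
  | push k a => exact .of_surjective (fun _ : Unit => Label.push) (by rintro ⟨⟩; exact ⟨(), rfl⟩)
  | seq p q ihp ihq =>
    refine .of_surjective (fun l : Label p ⊕ Label q => l.elim Label.left Label.right) ?_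
    rintro (_ | _)
    exacts [⟨.inl _, rfl⟩, ⟨.inr _, rfl⟩]
  | case k f ih =>
    refine .of_surjective (fun l : Option (Σ v, Label (f v)) =>
      l.elim Label.case fun l => Label.caseBody l.1 l.2) ?_
    rintro (_ | _)
    exacts [⟨none, rfl⟩, ⟨some ⟨_, _⟩, rfl⟩]
  | loop k quit f ih =>
    refine .of_surjective (fun l : Option (Σ v, Label (f v)) =>
      l.elim Label.loop fun l => Label.loopBody l.1 l.2) ?_
    rintro (_ | _)
    exacts [⟨none, rfl⟩, ⟨some ⟨_, _⟩, rfl⟩]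

/-- The statement at a control point, for a program whose control points are embedded by `e` into
those of a machine and that continues at `exit` when it ends. The internal state of the machine
is the last symbol popped. -/
def code {Λ : Type} : {p : Prog} → (Label p → Λ) → Λ → Label p →
    Turing.TM2.Stmt (fun _ : Reg => Γ') Λ (Option Γ')
  | .skip, _, exit, .skip => .goto fun _ => exit
  | .push k a, _, exit, .push => .push k (fun _ => a) (.goto fun _ => exit)
  | .seq _ q, e, _, .left l => code (fun l => e (.left l)) (e (.right (entry q))) l
  | .seq _ _, e, exit, .right l => code (fun l => e (.right l)) exit l
  | .case k f, e, _, .case =>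
    .pop k (fun _ v => v) (.goto fun v => e (.caseBody v (entry (f v))))
  | .case _ _, e, exit, .caseBody v l => code (fun l => e (.caseBody v l)) exit l
  | .loop k quit f, e, exit, .loop =>
    .pop k (fun _ v => v)
      (.goto fun v => if quit v then exit else e (.loopBody v (entry (f v))))
  | .loop _ _ _, e, _, .loopBody v l => code (fun l => e (.loopBody v l)) (e .loop) l

end Prog

/-- `Reaches M m c c'`: the machine `M` passes from `c` to `c'` in exactly `m` steps. -/
def Reaches {Λ : Type} (M : Λ → Turing.TM2.Stmt (fun _ : Reg => Γ') Λ (Option Γ')) (m : ℕ)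
    (c c' : Turing.TM2.Cfg (fun _ : Reg => Γ') Λ (Option Γ')) : Prop :=
  (flip bind (Turing.TM2.step M))^[m] (some c) = some c'

theorem Reaches.one {Λ : Type} {M : Λ → Turing.TM2.Stmt (fun _ : Reg => Γ') Λ (Option Γ')}
    {c c' : Turing.TM2.Cfg (fun _ : Reg => Γ') Λ (Option Γ')}
    (h : Turing.TM2.step M c = some c') : Reaches M 1 c c' := h

theorem Reaches.trans {Λ : Type} {M : Λ → Turing.TM2.Stmt (fun _ : Reg => Γ') Λ (Option Γ')}
    {m n : ℕ} {c c' c'' : Turing.TM2.Cfg (fun _ : Reg => Γ') Λ (Option Γ')}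
    (h : Reaches M m c c') (h' : Reaches M n c' c'') : Reaches M (m + n) c c'' := by
  unfold Reaches at *
  rw [add_comm, Function.iterate_add_apply, h, h']

/-- The embedding `e` and the control point `exit` are arbitrary because a subprogram occupies only
part of a machine and hands over to whatever follows it. The internal state at the end does not
matter: it is read only directly after a pop has set it. -/
theorem Exec.reaches {p : Prog} {n : ℕ} {s s' : Store} (h : Exec p n s s') {Λ : Type}
    (M : Λ → Turing.TM2.Stmt (fun _ : Reg => Γ') Λ (Option Γ')) (e : p.Label → Λ) (exit : Λ)
    (hM : ∀ l, M (e l) = Prog.code e exit l) (v : Option Γ') :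
    ∃ v' m, m ≤ n ∧ Reaches M m ⟨some (e p.entry), v, s.get⟩ ⟨some exit, v', s'.get⟩ := by
  induction h generalizing exit v with
  | skip h =>
    refine ⟨v, 1, h, .one ?_⟩
    simp only [Turing.TM2.step, hM, Prog.entry, Prog.code, Turing.TM2.stepAux]
  | push h =>
    refine ⟨v, 1, h, .one ?_⟩
    simp only [Turing.TM2.step, hM, Prog.entry, Prog.code, Turing.TM2.stepAux, Store.get_set]
  | @seq p q _ _ _ _ _ _ _ _ h ih₁ ih₂ =>
    obtain ⟨v₁, m₁, hm₁, h₁⟩ := ih₁ (fun l => e (.left l)) (e (.right q.entry))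
      (fun l => by rw [hM, Prog.code]) v
    obtain ⟨v₂, m₂, hm₂, h₂⟩ := ih₂ (fun l => e (.right l)) exit
      (fun l => by rw [hM, Prog.code]) v₁
    exact ⟨v₂, m₁ + m₂, by omega, h₁.trans h₂⟩
  | @case k f _ _ s _ _ h ih =>
    obtain ⟨v₁, m₁, hm₁, h₁⟩ := ih (fun l => e (.caseBody _ l)) exit
      (fun l => by rw [hM, Prog.code]) (s.get k).head?
    refine ⟨v₁, 1 + m₁, by omega, Reaches.trans (.one ?_) h₁⟩
    simp only [Turing.TM2.step, hM, Prog.entry, Prog.code, Turing.TM2.stepAux, Store.get_set]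
  | @quit k quit f _ s hs h =>
    refine ⟨(s.get k).head?, 1, h, .one ?_⟩
    simp only [Turing.TM2.step, hM, Prog.entry, Prog.code, Turing.TM2.stepAux, Store.get_set, hs,
      if_true]
  | @step k quit f _ _ _ s _ _ hs _ _ h ih₁ ih₂ =>
    obtain ⟨v₁, m₁, hm₁, h₁⟩ := ih₁ (fun l => e (.loopBody _ l)) (e .loop)
      (fun l => by rw [hM, Prog.code]) (s.get k).head?
    obtain ⟨v₂, m₂, hm₂, h₂⟩ := ih₂ e exit hM v₁
    refine ⟨v₂, 1 + m₁ + m₂, by omega, (Reaches.trans (.one ?_) h₁).trans h₂⟩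
    simp only [Turing.TM2.step, hM, Prog.entry, Prog.code, Turing.TM2.stepAux, Store.get_set, hs,
      Bool.false_eq_true, if_false]

/-- The machine that runs a program, with the accumulator as its input and output stack. -/
noncomputable def Prog.machine (p : Prog) : Turing.TM2ComputableAux Γ' Γ' where
  tm :=
    { K := Reg
      k₀ := .acc
      k₁ := .acc
      Γ := fun _ => Γ'
      Λ := Option p.Label
      main := some p.entry
      ΛFin := @Fintype.ofFinite _ (have := p.finite_label; inferInstance)
      σ := Option Γ'
      initialState := none
      Γk₀Fin := inferInstanceAs (Fintype Γ')
      -- The extra control point `none` restores the initial internal state, which a halted machine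
      -- has to show. This costs the one additional step in `Exec.outputsWithin`.
      m := fun l => l.elim (.load (fun _ => none) .halt) (Prog.code some none) }
  inputAlphabet := Equiv.refl _
  outputAlphabet := Equiv.refl _

theorem Exec.outputsWithin {p : Prog} {n : ℕ} {x y : List Γ'}
    (h : Exec p n ⟨x, [], [], [], []⟩ ⟨y, [], [], [], []⟩) :
    OutputsWithin p.machine x y (n + 1) := by
  obtain ⟨v, m, hm, hr⟩ := h.reaches
    (M := fun l : Option p.Label => l.elim (.load (fun _ => none) .halt) (Prog.code some none))
    some none (fun _ => rfl) none
  have hlast := hr.trans (.one (c' := ⟨none, none, Store.get ⟨y, [], [], [], []⟩⟩) rfl)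
  refine ⟨⟨⟨m + 1, ?_⟩, Nat.succ_le_succ hm⟩⟩
  have hin : Turing.initList p.machine.tm (x.map p.machine.inputAlphabet.symm) =
      ⟨some (some p.entry), none, Store.get ⟨x, [], [], [], []⟩⟩ := by
    refine congrArg (Turing.TM2.Cfg.mk _ _) (funext fun k => ?_)
    cases k <;> first | rfl | exact List.map_id x
  have hout : Turing.haltList p.machine.tm (y.map p.machine.outputAlphabet.symm) =
      ⟨none, none, Store.get ⟨y, [], [], [], []⟩⟩ := by
    refine congrArg (Turing.TM2.Cfg.mk _ _) (funext fun k => ?_)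
    cases k <;> first | rfl | exact List.map_id y
  exact (congrArg (fun c => (flip bind p.machine.tm.step)^[m + 1] (some c)) hin).trans
    (Eq.trans hlast (congrArg some hout).symm)

/-! ### Trees and their bracket notation -/

/-- Binary words and lists of trees in one datatype: the empty list, a list that starts with a bit,
and a list that starts with a list. -/
inductive Data : Type
  | nil
  | bit (b : Bool) (d : Data)
  | node (a d : Data)

namespace Data

/-- The bracket notation for a tree. -/
def enc : Data → List Γ'
  | nil => []
  | bit b d => .bit b :: enc d
  | node a d => .bra :: (enc a ++ .ket :: enc d)

/-- The length of the bracket notation for a tree. -/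
def size (d : Data) : ℕ := d.enc.length

@[simp] theorem size_nil : size nil = 0 := rfl
@[simp] theorem size_bit (b : Bool) (d : Data) : size (bit b d) = size d + 1 := rfl
@[simp] theorem size_node (a d : Data) : size (node a d) = size a + size d + 2 := by
  simp [size, enc]; omega

/-- Concatenation. -/
def append : Data → Data → Data
  | nil, e => e
  | bit b d, e => bit b (append d e)
  | node a d, e => node a (append d e)

@[simp] theorem enc_append (d e : Data) : enc (append d e) = enc d ++ enc e := by
  induction d <;> simp_all [append, enc]

/-- Unique readability of the bracket notation. -/
theorem enc_append_ket_inj (d : Data) : ∀ (d' : Data) (x y : List Γ'),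
    d.enc ++ .ket :: x = d'.enc ++ .ket :: y → d = d' ∧ x = y := by
  induction d with
  | nil => intro d' x y h; cases d' <;> simp_all [enc]
  | bit b d ih =>
    intro d' x y h
    cases d' with
    | bit b' d' =>
      simp only [enc, List.cons_append, List.cons.injEq, Γ'.bit.injEq] at h
      obtain ⟨rfl, rfl⟩ := ih d' x y h.2
      simp [h.1]
    | _ => simp [enc] at h
  | node a d iha ihd =>
    intro d' x y h
    cases d' with
    | node a' d' =>
      simp only [enc, List.cons_append, List.append_assoc, List.cons.injEq, true_and] at h
      obtain ⟨rfl, h₁⟩ := iha _ _ _ h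
      obtain ⟨rfl, rfl⟩ := ihd _ _ _ h₁
      simp
    | _ => simp [enc] at h

theorem enc_injective : Function.Injective enc := fun d d' h =>
  (enc_append_ket_inj d d' [] [] (by rw [h])).1

end Data

/-! ### Basic programs -/

namespace Prog

/-- Moves the contents of `j` to `k`, reversing their order. -/
def move (j k : Reg) : Prog :=
  .loop j Option.isNone fun v => .push k (v.getD .blank)

/-- Empties the register `k`. -/
def clear (k : Reg) : Prog :=
  .loop k Option.isNone fun _ => .skip

/-- Pops a symbol. -/
def pop (k : Reg) : Prog :=
  .case k fun _ => .skip

/-- Moves a symbol to the temporary register and updates the number of brackets that are still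
open. -/
def takeStep : Option Γ' → Prog
  | some (.bit b) => .push .tmp (.bit b) ;; .push .cnt .blank
  | some .bra => .push .tmp .bra ;; .push .cnt .blank ;; .push .cnt .blank
  | some .ket => .push .tmp .ket
  | _ => .skip

/-- Moves the symbols from `k` to the temporary register until all open brackets are closed. -/
def takeLoop (k : Reg) : Prog :=
  .loop .cnt Option.isNone fun _ => .case k takeStep

/-- Moves the symbols from `k` to the temporary register, up to and including the first closing
bracket that is not matched. -/
def take (k : Reg) : Prog :=
  .push .cnt .blank ;; takeLoop k

end Prog

open Prog

/-- `F x y` stands for the store with `x` in `j`, `y` in `k` and fixed contents elsewhere. The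
equations for `F` force the two registers to be distinct and let one induction serve every pair of
registers. -/
theorem exec_move {j k : Reg} (F : List Γ' → List Γ' → Store)
    (hj : ∀ x y, (F x y).get j = x) (hk : ∀ x y, (F x y).get k = y)
    (hj' : ∀ x y z, (F x y).set j z = F z y) (hk' : ∀ x y z, (F x y).set k z = F x z)
    (x y : List Γ') : Exec (move j k) (2 * x.length + 1) (F x y) (F [] (x.reverse ++ y)) := by
  induction x generalizing y with
  | nil =>
    have h := Exec.quit (k := j) (quit := Option.isNone)
      (f := fun v => .push k (v.getD .blank)) (r := 1) (s := F [] y) (by simp [hj]) le_rfl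
    simpa [move, hj, hj'] using h
  | cons a x ih =>
    refine .step (m := 1) (s' := F x (a :: y)) (by simp [hj]) ?_
      (by simpa [move] using ih (a :: y)) ?_
    · have h := Exec.push (k := k) (a := a) (n := 1) (s := F x y) le_rfl
      simpa [hj, hj', hk, hk'] using h
    · simp; omega

theorem exec_clear {k : Reg} (F : List Γ' → Store) (hk : ∀ x, (F x).get k = x)
    (hk' : ∀ x z, (F x).set k z = F z) (x : List Γ') :
    Exec (clear k) (2 * x.length + 1) (F x) (F []) := by
  induction x with
  | nil =>
    have h := Exec.quit (k := k) (quit := Option.isNone)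
      (f := fun _ => .skip) (r := 1) (s := F []) (by simp [hk]) le_rfl
    simpa [clear, hk, hk'] using h
  | cons a x ih =>
    refine .step (m := 1) (s' := F x) (by simp [hk]) ?_ ih ?_
    · have h := Exec.skip (n := 1) (s := F x) le_rfl
      simpa [hk, hk'] using h
    · simp; omega

/-- The register `cnt` counts in unary the closing brackets still awaited, including the unmatched
one. A symbol costs at most five steps, attained at an opening bracket: two pops and three pushes.
-/
theorem exec_take {k : Reg} (F : List Γ' → List Γ' → List Γ' → Store)
    (hk : ∀ x t c, (F x t c).get k = x) (ht : ∀ x t c, (F x t c).tmp = t)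
    (hc : ∀ x t c, (F x t c).cnt = c)
    (hk' : ∀ x t c z, (F x t c).set k z = F z t c)
    (ht' : ∀ x t c z, (F x t c).set .tmp z = F x z c)
    (hc' : ∀ x t c z, (F x t c).set .cnt z = F x t z) (d : Data) (x t : List Γ') :
    Exec (take k) (5 * d.size + 6) (F (d.enc ++ .ket :: x) t [])
      (F x (.ket :: (d.enc.reverse ++ t)) []) := by
  have hgt : ∀ x t c, (F x t c).get .tmp = t := ht
  have hgc : ∀ x t c, (F x t c).get .cnt = c := hc
  have push_t : ∀ a x t c, Exec (.push .tmp a) 1 (F x t c) (F x (a :: t) c) := fun a x t c => by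
    have h := Exec.push (k := .tmp) (a := a) (n := 1) (s := F x t c) le_rfl
    simpa [hgt, ht'] using h
  have push_c : ∀ a x t c, Exec (.push .cnt a) 1 (F x t c) (F x t (a :: c)) := fun a x t c => by
    have h := Exec.push (k := .cnt) (a := a) (n := 1) (s := F x t c) le_rfl
    simpa [hgc, hc'] using h
  have step : ∀ {a x t c m n s s'}, Exec (takeStep (some a)) m (F x t c) s →
      Exec (takeLoop k) n s s' → Exec (takeLoop k) (m + n + 2) (F (a :: x) t (.blank :: c)) s' := by
    intro a x t c m n s s' h h'
    refine .step (m := m + 1) (s' := s) (by simp [hgc]) (.case (n := m) ?_ le_rfl) h' (by omega)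
    simpa [hgc, hc', hk, hk'] using h
  -- In continuation form: a run of the loop on what follows `d` extends to a run that first reads
  -- `d`. Thus the two hypotheses for a node can be chained inside the same loop.
  have key : ∀ (d : Data) (x t c : List Γ') n s',
      Exec (takeLoop k) n (F x (d.enc.reverse ++ t) (.blank :: c)) s' →
      Exec (takeLoop k) (5 * d.size + n) (F (d.enc ++ x) t (.blank :: c)) s' := by
    intro d
    induction d with
    | nil => intro x t c n s' h; simpa [Data.enc] using h
    | bit b d ih =>
      intro x t c n s' h
      refine (step (a := .bit b) (.seq (push_t _ _ _ _) (push_c _ _ _ _) le_rfl)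
        (ih x (.bit b :: t) c n s' (by simpa [Data.enc] using h))).mono ?_
      simp; omega
    | node a d iha ihd =>
      intro x t c n s' h
      have h₂ := ihd x (.ket :: (a.enc.reverse ++ .bra :: t)) c n s'
        (by simpa [Data.enc] using h)
      have h₁ := iha (.ket :: (d.enc ++ x)) (.bra :: t) (.blank :: c) _ s'
        (step (a := .ket) (push_t _ _ _ _) h₂)
      have h₀ := step (a := .bra) (.seq (push_t _ _ _ _)
        (.seq (push_c _ _ _ _) (push_c _ _ _ _) le_rfl) le_rfl) h₁
      simp only [Data.enc, List.cons_append, List.append_assoc]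
      refine h₀.mono ?_
      simp; omega
  have quit : Exec (takeLoop k) 1 (F x (.ket :: (d.enc.reverse ++ t)) [])
      (F x (.ket :: (d.enc.reverse ++ t)) []) := by
    have h := Exec.quit (k := .cnt) (quit := Option.isNone) (f := fun _ => .case k takeStep)
      (r := 1) (s := F x (.ket :: (d.enc.reverse ++ t)) []) (by simp [hgc]) le_rfl
    simpa [takeLoop, hgc, hc'] using h
  exact .seq (push_c _ _ _ _) (key d _ _ _ _ _ (step (a := .ket) (push_t _ _ _ _) quit)) (by omega)

theorem exec_move_acc_tmp (x s t c u : List Γ') : Exec (move .acc .tmp) (2 * x.length + 1)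
    ⟨x, s, t, c, u⟩ ⟨[], s, x.reverse ++ t, c, u⟩ :=
  exec_move (fun x t => ⟨x, s, t, c, u⟩) (fun _ _ => rfl) (fun _ _ => rfl) (fun _ _ _ => rfl)
    (fun _ _ _ => rfl) x t

theorem exec_move_acc_aux (x s t c u : List Γ') : Exec (move .acc .aux) (2 * x.length + 1)
    ⟨x, s, t, c, u⟩ ⟨[], s, t, c, x.reverse ++ u⟩ :=
  exec_move (fun x u => ⟨x, s, t, c, u⟩) (fun _ _ => rfl) (fun _ _ => rfl) (fun _ _ _ => rfl)
    (fun _ _ _ => rfl) x u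

theorem exec_move_tmp_acc (x s t c u : List Γ') : Exec (move .tmp .acc) (2 * t.length + 1)
    ⟨x, s, t, c, u⟩ ⟨t.reverse ++ x, s, [], c, u⟩ :=
  exec_move (fun t x => ⟨x, s, t, c, u⟩) (fun _ _ => rfl) (fun _ _ => rfl) (fun _ _ _ => rfl)
    (fun _ _ _ => rfl) t x

theorem exec_move_tmp_save (x s t c u : List Γ') : Exec (move .tmp .save) (2 * t.length + 1)
    ⟨x, s, t, c, u⟩ ⟨x, t.reverse ++ s, [], c, u⟩ :=
  exec_move (fun t s => ⟨x, s, t, c, u⟩) (fun _ _ => rfl) (fun _ _ => rfl) (fun _ _ _ => rfl)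
    (fun _ _ _ => rfl) t s

theorem exec_move_tmp_aux (x s t c u : List Γ') : Exec (move .tmp .aux) (2 * t.length + 1)
    ⟨x, s, t, c, u⟩ ⟨x, s, [], c, t.reverse ++ u⟩ :=
  exec_move (fun t u => ⟨x, s, t, c, u⟩) (fun _ _ => rfl) (fun _ _ => rfl) (fun _ _ _ => rfl)
    (fun _ _ _ => rfl) t u

theorem exec_move_aux_save (x s t c u : List Γ') : Exec (move .aux .save) (2 * u.length + 1)
    ⟨x, s, t, c, u⟩ ⟨x, u.reverse ++ s, t, c, []⟩ :=
  exec_move (fun u s => ⟨x, s, t, c, u⟩) (fun _ _ => rfl) (fun _ _ => rfl) (fun _ _ _ => rfl)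
    (fun _ _ _ => rfl) u s

theorem exec_clear_acc (x s t c u : List Γ') : Exec (clear .acc) (2 * x.length + 1)
    ⟨x, s, t, c, u⟩ ⟨[], s, t, c, u⟩ :=
  exec_clear (fun x => ⟨x, s, t, c, u⟩) (fun _ => rfl) (fun _ _ => rfl) x

theorem exec_clear_tmp (x s t c u : List Γ') : Exec (clear .tmp) (2 * t.length + 1)
    ⟨x, s, t, c, u⟩ ⟨x, s, [], c, u⟩ :=
  exec_clear (fun t => ⟨x, s, t, c, u⟩) (fun _ => rfl) (fun _ _ => rfl) t

theorem exec_take_acc (d : Data) (x s t u : List Γ') : Exec (take .acc) (5 * d.size + 6)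
    ⟨d.enc ++ .ket :: x, s, t, [], u⟩ ⟨x, s, .ket :: (d.enc.reverse ++ t), [], u⟩ :=
  exec_take (fun x t c => ⟨x, s, t, c, u⟩) (fun _ _ _ => rfl) (fun _ _ _ => rfl)
    (fun _ _ _ => rfl) (fun _ _ _ _ => rfl) (fun _ _ _ _ => rfl) (fun _ _ _ _ => rfl) d x t

theorem exec_take_save (d : Data) (x s t u : List Γ') : Exec (take .save) (5 * d.size + 6)
    ⟨x, d.enc ++ .ket :: s, t, [], u⟩ ⟨x, s, .ket :: (d.enc.reverse ++ t), [], u⟩ :=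
  exec_take (fun s t c => ⟨x, s, t, c, u⟩) (fun _ _ _ => rfl) (fun _ _ _ => rfl)
    (fun _ _ _ => rfl) (fun _ _ _ _ => rfl) (fun _ _ _ _ => rfl) (fun _ _ _ _ => rfl) d s t

theorem exec_pop {k : Reg} (s : Store) : Exec (pop k) 2 s (s.set k (s.get k).tail) :=
  .case (.skip le_rfl) le_rfl

open Prog

/-! ### Programs that operate on trees -/

/-- The store with accumulator `x` and save stack `s`, all temporaries being empty. -/
abbrev Store.idle (x s : List Γ') : Store := ⟨x, s, [], [], []⟩

namespace Prog

/-- Pushes a copy of the accumulator, with a closing bracket, on the save stack. -/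
def dup : Prog :=
  move .acc .tmp ;; .push .save .ket ;;
    .loop .tmp Option.isNone fun v => .push .acc (v.getD .blank) ;; .push .save (v.getD .blank)

/-- Exchanges the accumulator and the top tree of the save stack. -/
def swap : Prog :=
  move .acc .aux ;; take .save ;; pop .tmp ;; .push .save .ket ;; move .aux .save ;; move .tmp .acc

/-- Pops a tree from the save stack and pairs it with the accumulator. -/
def join : Prog :=
  take .save ;; move .tmp .acc ;; .push .acc .bra

/-- Runs both programs on the accumulator and pairs the results. -/
def pair (p q : Prog) : Prog :=
  dup ;; p ;; swap ;; q ;; join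

/-- The first component of a pair. -/
def fst : Prog :=
  pop .acc ;; take .acc ;; clear .acc ;; pop .tmp ;; move .tmp .acc

/-- The second component of a pair. -/
def snd : Prog :=
  pop .acc ;; take .acc ;; clear .tmp

/-- The concatenation of the components of a pair. -/
def append : Prog :=
  pop .acc ;; take .acc ;; pop .tmp ;; move .tmp .acc

/-- Pushes a string on the accumulator. -/
def pushAll : List Γ' → Prog
  | [] => .skip
  | a :: x => pushAll x ;; .push .acc a

/-- Runs `p` or `q` on the second component of a pair, depending on the bit that is its first
component. -/
def branch (p q : Prog) : Prog :=
  pop .acc ;; .case .acc fun v => pop .acc ;; if v = some (.bit true) then p else q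

/-- Marks the temporary register if the string in the auxiliary register is not a prefix of the
accumulator, and removes this prefix otherwise. -/
def compare : Prog :=
  .loop .aux Option.isNone fun v => .case .acc fun w => if v = w then .skip else .push .tmp .blank

/-- Tests the components of a pair for equality. -/
def eq : Prog :=
  pop .acc ;; take .acc ;; pop .tmp ;; move .tmp .aux ;; compare ;;
    (.case .acc fun w => if w = none then .skip else .push .tmp .blank) ;; clear .acc ;;
    .case .tmp fun v => clear .tmp ;; .push .acc (.bit (v = none))

/-- Tests whether the first bit is set. -/
def headBit : Prog :=
  .case .acc fun v => clear .acc ;; .push .acc (.bit (v = some (.bit true)))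

/-- Runs `p` on the pairs of an item of the list on the save stack and the accumulator. -/
def foldLoop (p : Prog) : Prog :=
  .loop .save (fun v => v ≠ some .bra) fun _ =>
    take .save ;; move .tmp .acc ;; .push .acc .bra ;; p

/-- Folds `p` over the list that is the first component of a pair, starting with its second
component. -/
def fold (p : Prog) : Prog :=
  pop .acc ;; take .acc ;; move .tmp .save ;; foldLoop p

end Prog

theorem exec_dup (x s : List Γ') :
    Exec dup (5 * x.length + 4) (.idle x s) (.idle x (x ++ .ket :: s)) := by
  have key : ∀ t x s : List Γ', Exec (.loop .tmp Option.isNone fun v =>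
      .push .acc (v.getD .blank) ;; .push .save (v.getD .blank)) (3 * t.length + 1)
      ⟨x, s, t, [], []⟩ ⟨t.reverse ++ x, t.reverse ++ s, [], [], []⟩ := by
    intro t
    induction t with
    | nil => intro x s; exact .quit rfl le_rfl
    | cons a t ih =>
      intro x s
      refine .step (m := 2) (s' := ⟨a :: x, a :: s, t, [], []⟩) rfl
        (.seq (.push le_rfl) (.push le_rfl) le_rfl) (by simpa using ih (a :: x) (a :: s)) ?_
      simp; omega
  have h := key x.reverse [] (.ket :: s)
  have h' := exec_move_acc_tmp x s [] [] []
  simp only [List.append_nil, List.reverse_reverse, List.length_reverse] at h h'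
  exact .seq h' (.seq (.push le_rfl) h le_rfl) (by omega)

theorem exec_swap (x : Data) (y s : List Γ') :
    Exec swap (4 * y.length + 7 * x.size + 13) (.idle y (x.enc ++ .ket :: s))
      (.idle x.enc (y ++ .ket :: s)) := by
  have h₁ := exec_move_acc_aux y (x.enc ++ .ket :: s) [] [] []
  have h₂ := exec_take_save x [] s [] (y.reverse ++ [])
  have h₃ := exec_pop (k := .tmp) ⟨[], s, .ket :: (x.enc.reverse ++ []), [], y.reverse ++ []⟩
  have h₄ : Exec (.push .save .ket) 1 ⟨[], s, x.enc.reverse ++ [], [], y.reverse ++ []⟩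
    ⟨[], .ket :: s, x.enc.reverse ++ [], [], y.reverse ++ []⟩ := .push le_rfl
  have h₅ := exec_move_aux_save [] (.ket :: s) (x.enc.reverse ++ []) [] (y.reverse ++ [])
  have h₆ := exec_move_tmp_acc [] ((y.reverse ++ []).reverse ++ .ket :: s)
    (x.enc.reverse ++ []) [] []
  have h := Exec.seq h₁ (.seq h₂ (.seq h₃ (.seq h₄ (.seq h₅ h₆ le_rfl) le_rfl) le_rfl) le_rfl) le_rfl
  simp only [List.append_nil, List.reverse_reverse, List.length_reverse] at h
  exact h.mono (by simp only [Data.size]; omega)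

theorem exec_join (x : Data) (y s : List Γ') :
    Exec join (7 * x.size + 10) (.idle y (x.enc ++ .ket :: s))
      (.idle (.bra :: (x.enc ++ .ket :: y)) s) := by
  have h₁ := exec_take_save x y s [] []
  have h₂ := exec_move_tmp_acc y s (.ket :: (x.enc.reverse ++ [])) [] []
  have h := Exec.seq h₁ (.seq h₂ (.push (k := .acc) (a := .bra) le_rfl) le_rfl) le_rfl
  simp only [List.append_nil, List.reverse_cons, List.reverse_reverse, List.append_assoc,
    List.cons_append, List.nil_append] at h
  exact h.mono (by simp [Data.size]; omega)

/-- Since `p` and `q` are specified for every save stack, the copy of `x`, and later the result of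
`p`, can lie there undisturbed while the other work is done. -/
theorem exec_pair {p q : Prog} {m n : ℕ} {x y z : Data}
    (hp : ∀ s, Exec p m (.idle x.enc s) (.idle y.enc s))
    (hq : ∀ s, Exec q n (.idle x.enc s) (.idle z.enc s)) (s : List Γ') :
    Exec (pair p q) (m + n + 12 * x.size + 11 * y.size + 27) (.idle x.enc s)
      (.idle (y.node z).enc s) :=
  .seq (exec_dup _ _) (.seq (hp _) (.seq (exec_swap x y.enc s) (.seq (hq _) (exec_join y _ _)
    le_rfl) le_rfl) le_rfl) (by simp only [Data.size]; omega)

theorem exec_fst (x y : Data) (s : List Γ') :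
    Exec fst (7 * x.size + 2 * y.size + 12) (.idle (x.node y).enc s) (.idle x.enc s) := by
  have h₁ := exec_take_acc x y.enc s [] []
  have h₂ := exec_clear_acc y.enc s (.ket :: (x.enc.reverse ++ [])) [] []
  have h₃ := exec_pop (k := .tmp) ⟨[], s, .ket :: (x.enc.reverse ++ []), [], []⟩
  have h₄ := exec_move_tmp_acc [] s (x.enc.reverse ++ []) [] []
  have h := Exec.seq (exec_pop (k := .acc) (.idle (x.node y).enc s))
    (.seq h₁ (.seq h₂ (.seq h₃ h₄ le_rfl) le_rfl) le_rfl) le_rfl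
  simp only [List.append_nil, List.reverse_reverse, List.length_reverse] at h
  exact h.mono (by simp only [Data.size]; omega)

theorem exec_snd (x y : Data) (s : List Γ') :
    Exec snd (7 * x.size + 11) (.idle (x.node y).enc s) (.idle y.enc s) := by
  have h₁ := exec_take_acc x y.enc s [] []
  have h₂ := exec_clear_tmp y.enc s (.ket :: (x.enc.reverse ++ [])) [] []
  have h := Exec.seq (exec_pop (k := .acc) (.idle (x.node y).enc s)) (.seq h₁ h₂ le_rfl) le_rfl
  exact h.mono (by simp [Data.size]; omega)

/-- On empty stacks every pop yields `none` and nothing is moved. This makes `fst` and `snd` total,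
as needed for the head, with default `[]`, and the tail of an empty list. -/
theorem exec_take_acc_nil (s : List Γ') : Exec (take .acc) 5 (.idle [] s) (.idle [] s) :=
  .seq (.push le_rfl) (.step (m := 2) (s' := .idle [] s) rfl (.case (.skip le_rfl) le_rfl)
    (.quit (r := 1) rfl le_rfl) le_rfl) (by omega)

theorem exec_fst_nil (s : List Γ') : Exec fst 11 (.idle [] s) (.idle [] s) :=
  .seq (exec_pop _) (.seq (exec_take_acc_nil s) (.seq (exec_clear_acc _ _ _ _ _)
    (.seq (exec_pop _) (exec_move_tmp_acc _ _ _ _ _) le_rfl) le_rfl) le_rfl) le_rfl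

theorem exec_snd_nil (s : List Γ') : Exec snd 8 (.idle [] s) (.idle [] s) :=
  .seq (exec_pop _) (.seq (exec_take_acc_nil s) (exec_clear_tmp _ _ _ _ _) le_rfl) le_rfl

theorem exec_append (x y : Data) (s : List Γ') :
    Exec append (7 * x.size + 11) (.idle (x.node y).enc s) (.idle (x.append y).enc s) := by
  have h₁ := exec_take_acc x y.enc s [] []
  have h₃ := exec_pop (k := .tmp) ⟨y.enc, s, .ket :: (x.enc.reverse ++ []), [], []⟩
  have h₄ := exec_move_tmp_acc y.enc s (x.enc.reverse ++ []) [] []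
  have h := Exec.seq (exec_pop (k := .acc) (.idle (x.node y).enc s))
    (.seq h₁ (.seq h₃ h₄ le_rfl) le_rfl) le_rfl
  simp only [List.append_nil, List.reverse_reverse, List.length_reverse] at h
  rw [Data.enc_append]
  exact h.mono (by simp only [Data.size]; omega)

theorem exec_pushAll (x y s : List Γ') :
    Exec (pushAll x) (x.length + 1) (.idle y s) (.idle (x ++ y) s) := by
  induction x with
  | nil => exact .skip le_rfl
  | cons a x ih => exact .seq ih (.push le_rfl) le_rfl

theorem exec_branch {p q : Prog} {m n : ℕ} {b : Bool} {x y z : Data}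
    (hp : b = true → ∀ s, Exec p m (.idle x.enc s) (.idle y.enc s))
    (hq : b = false → ∀ s, Exec q n (.idle x.enc s) (.idle z.enc s)) (s : List Γ') :
    Exec (branch p q) (m + n + 5) (.idle ((Data.bit b .nil).node x).enc s)
      (.idle (bif b then y else z).enc s) := by
  refine .seq (exec_pop _) (.case (n := m + n + 2)
    (.seq (m := 2) (n := m + n) (s' := .idle x.enc s) (exec_pop _) ?_ (by omega)) le_rfl) (by omega)
  cases b with
  | true => exact (hp rfl s).mono (by omega)
  | false => exact (hq rfl s).mono (by omega)

/-- Every mismatch leaves a mark in the temporary register and the comparison goes on. Only the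
presence of marks matters, so their number is left existential apart from the bound used for timing.
-/
theorem exec_compare (x y s t : List Γ') : ∃ t', t'.length ≤ x.length + t.length ∧
    (t' = [] ↔ t = [] ∧ x <+: y) ∧
    Exec compare (3 * x.length + 1) ⟨y, s, t, [], x⟩ ⟨y.drop x.length, s, t', [], []⟩ := by
  induction x generalizing y t with
  | nil => exact ⟨t, by simp, by simp, .quit rfl le_rfl⟩
  | cons a x ih =>
    by_cases h : some a = y.head?
    · obtain ⟨y, rfl⟩ : ∃ y', y = a :: y' := by cases y <;> simp_all
      obtain ⟨t', ht, h₁, h₂⟩ := ih y t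
      refine ⟨t', by simp; omega, by simpa [List.cons_prefix_cons] using h₁, ?_⟩
      refine .step (m := 2) (s' := ⟨y, s, t, [], x⟩) rfl (.case (n := 1) ?_ le_rfl) h₂
        (by simp; omega)
      change Exec (if some a = some a then _ else _) _ _ _
      rw [if_pos rfl]
      exact .skip le_rfl
    · obtain ⟨t', ht, h₁, h₂⟩ := ih y.tail (.blank :: t)
      refine ⟨t', by simp at ht ⊢; omega, ?_, ?_⟩
      · rw [h₁]
        refine iff_of_false (by simp) fun h' => h ?_
        obtain ⟨z, hz⟩ := h'.2
        simp [← hz]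
      · refine .step (m := 2) (s' := ⟨y.tail, s, .blank :: t, [], x⟩) rfl (.case (n := 1) ?_ le_rfl)
          (by simpa [Prog.compare] using h₂) (by simp; omega)
        change Exec (if some a = y.head? then _ else _) _ _ _
        rw [if_neg h]
        exact .push le_rfl

/-- By unique readability the trees agree if and only if their strings do, that is, if the first is
a prefix of the second and nothing of the second is left over. -/
theorem exec_eq {x y : Data} {b : Bool} (hb : b = true ↔ x = y) (s : List Γ') :
    Exec eq (12 * x.size + 2 * y.size + 21) (.idle (x.node y).enc s)
      (.idle (Data.bit b .nil).enc s) := by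
  obtain ⟨t, ht, h₁, h₂⟩ := exec_compare x.enc y.enc s []
  have e₁ := exec_take_acc x y.enc s [] []
  have e₂ := exec_pop (k := .tmp) ⟨y.enc, s, .ket :: (x.enc.reverse ++ []), [], []⟩
  have e₃ := exec_move_tmp_aux y.enc s (x.enc.reverse ++ []) [] []
  simp only [List.append_nil, List.reverse_reverse, List.length_reverse] at e₁ e₂ e₃ h₁ ht
  obtain ⟨t', ht', h₃, h₄⟩ : ∃ t' : List Γ', t'.length ≤ t.length + 1 ∧
      (b = decide (t'.head? = none)) ∧
      Exec (.case .acc fun w => if w = none then .skip else .push .tmp .blank) 2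
        ⟨y.enc.drop x.enc.length, s, t, [], []⟩
        ⟨(y.enc.drop x.enc.length).tail, s, t', [], []⟩ := by
    by_cases h : (y.enc.drop x.enc.length).head? = none
    · refine ⟨t, by omega, ?_, .case (n := 1) ?_ le_rfl⟩
      · rw [Bool.eq_iff_iff, hb, decide_eq_true_iff, List.head?_eq_none_iff, h₁,
          ← Data.enc_injective.eq_iff]
        rw [List.head?_eq_none_iff, List.drop_eq_nil_iff] at h
        simp only [true_and]
        exact ⟨fun h => h ▸ List.prefix_rfl, fun h' => h'.eq_of_length_le h⟩
      · change Exec (if (y.enc.drop x.enc.length).head? = none then _ else _) _ _ _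
        rw [if_pos h]
        exact .skip le_rfl
    · refine ⟨.blank :: t, by simp, ?_, .case (n := 1) ?_ le_rfl⟩
      · rw [Bool.eq_iff_iff, hb]
        simp only [List.head?_cons, reduceCtorEq, decide_false, Bool.false_eq_true, iff_false]
        rintro rfl
        simp at h
      · change Exec (if (y.enc.drop x.enc.length).head? = none then _ else _) _ _ _
        rw [if_neg h]
        exact .push le_rfl
  have e₄ := exec_clear_acc (y.enc.drop x.enc.length).tail s t' [] []
  have e₅ := exec_clear_tmp [] s t'.tail [] []
  have e₆ := Exec.case (k := .tmp) (s := ⟨[], s, t', [], []⟩)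
    (f := fun v => clear .tmp ;; .push .acc (.bit (v = none)))
    (.seq e₅ (.push (k := .acc) (a := .bit (decide (t'.head? = none))) le_rfl) le_rfl) le_rfl
  have h := Exec.seq (exec_pop (k := .acc) (.idle (x.node y).enc s)) (.seq e₁ (.seq e₂ (.seq e₃
    (.seq h₂ (.seq h₄ (.seq e₄ e₆ le_rfl) le_rfl) le_rfl) le_rfl) le_rfl) le_rfl) le_rfl
  subst h₃
  refine h.mono ?_
  simp only [Data.size, List.length_tail, List.length_drop, List.length_nil] at ht ⊢
  omega

theorem exec_headBit (b : Bool) (x : Data) (s : List Γ') :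
    Exec headBit (2 * x.size + 3) (.idle (x.bit b).enc s) (.idle (Data.bit b .nil).enc s) := by
  have h := Exec.case (k := .acc) (s := .idle (x.bit b).enc s)
    (f := fun v => clear .acc ;; .push .acc (.bit (v = some (.bit true))))
    (.seq (exec_clear_acc _ _ _ _ _) (.push le_rfl) le_rfl) le_rfl
  cases b <;> exact h.mono le_rfl

/-- The unmatched closing bracket after the list ends the loop. The hypothesis on `p` concerns only
states that actually arise, so that `n` may depend on a bound for intermediate results. As each item
has brackets of its own, charging `n + 7` to every symbol is enough. -/
theorem exec_foldLoop {α β : Type} (c : α → Data) (d : β → Data) (g : β → α → β) {p : Prog} {n : ℕ}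
    (l : List α) (b : β)
    (hp : ∀ l₁ a l₂, l = l₁ ++ a :: l₂ → ∀ s,
      Exec p n (.idle ((c a).node (d (l₁.foldl g b))).enc s) (.idle (d (g (l₁.foldl g b) a)).enc s))
    (s : List Γ') :
    Exec (foldLoop p) ((n + 7) * (l.foldr (fun a e => (c a).node e) .nil).size + 1)
      (.idle (d b).enc ((l.foldr (fun a e => (c a).node e) .nil).enc ++ .ket :: s))
      (.idle (d (l.foldl g b)).enc s) := by
  induction l generalizing b with
  | nil => exact .quit rfl (by simp)
  | cons a l ih =>
    have h := ih (g b a) fun l₁ a' l₂ e s => by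
      simpa using hp (a :: l₁) a' l₂ (by simp [e]) s
    have h₀ := hp [] a l rfl
    have e₁ := exec_take_save (c a) (d b).enc
      ((l.foldr (fun a e => (c a).node e) .nil).enc ++ .ket :: s) [] []
    have e₂ := exec_move_tmp_acc (d b).enc
      ((l.foldr (fun a e => (c a).node e) .nil).enc ++ .ket :: s)
      (.ket :: ((c a).enc.reverse ++ [])) [] []
    simp only [List.append_nil, List.reverse_cons, List.reverse_reverse, List.append_assoc,
      List.cons_append, List.nil_append] at e₁ e₂
    have e₃ := Exec.seq e₁ (.seq e₂ (.seq (.push (k := .acc) (a := .bra) le_rfl) (h₀ _) le_rfl)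
      le_rfl) le_rfl
    simp only [List.foldr_cons, Data.enc, List.cons_append, List.append_assoc]
    refine .step rfl e₃ h ?_
    simp [Data.size_node]
    simp only [Data.size]
    nlinarith [Nat.zero_le (n * (c a).enc.length)]

theorem exec_fold {α β : Type} (c : α → Data) (d : β → Data) (g : β → α → β) {p : Prog} {n : ℕ}
    (l : List α) (b : β)
    (hp : ∀ l₁ a l₂, l = l₁ ++ a :: l₂ → ∀ s,
      Exec p n (.idle ((c a).node (d (l₁.foldl g b))).enc s) (.idle (d (g (l₁.foldl g b) a)).enc s))
    (s : List Γ') :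
    Exec (fold p) ((n + 14) * (l.foldr (fun a e => (c a).node e) .nil).size + 12)
      (.idle ((l.foldr (fun a e => (c a).node e) .nil).node (d b)).enc s)
      (.idle (d (l.foldl g b)).enc s) := by
  have e₁ := exec_take_acc (l.foldr (fun a e => (c a).node e) .nil) (d b).enc s [] []
  have e₂ := exec_move_tmp_save (d b).enc s
    (.ket :: ((l.foldr (fun a e => (c a).node e) .nil).enc.reverse ++ [])) [] []
  simp only [List.append_nil, List.reverse_cons, List.reverse_reverse, List.append_assoc,
    List.cons_append, List.nil_append] at e₁ e₂
  have h := Exec.seq (exec_pop (k := .acc)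
    (.idle ((l.foldr (fun a e => (c a).node e) .nil).node (d b)).enc s))
    (.seq e₁ (.seq e₂ (exec_foldLoop c d g l b hp s) le_rfl) le_rfl) le_rfl
  refine h.mono ?_
  simp [Data.size]
  nlinarith

open Prog

/-! ### Functions computable in polynomial time -/

/-- A type whose elements are represented by trees. The weight of an element is the parameter in
which running times are measured. -/
class Coded (α : Type) where
  toData : α → Data
  weight : α → ℕ
  size_le : ∀ a, (toData a).size ≤ weight a

open Coded (toData weight)

instance : Coded Unit where
  toData _ := .nil
  weight _ := 0
  size_le _ := le_rfl

instance {α β : Type} [Coded α] [Coded β] : Coded (α × β) where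
  toData x := (toData x.1).node (toData x.2)
  weight x := weight x.1 + weight x.2 + 2
  size_le x := by
    have := Coded.size_le x.1
    have := Coded.size_le x.2
    simp; omega

instance {α : Type} [Coded α] : Coded (List α) where
  toData l := l.foldr (fun a d => (toData a).node d) .nil
  weight l := (l.map fun a => weight a + 2).sum
  size_le l := by
    induction l with
    | nil => simp
    | cons a l ih =>
      have := Coded.size_le a
      simp only [List.foldr_cons, Data.size_node, List.map_cons, List.sum_cons]
      omega

/-- A word is a bare string of bits, without brackets around its entries. The instance for lists
does not compete, since `Bool` itself is not coded. -/
instance : Coded (List Bool) where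
  toData w := w.foldr .bit .nil
  weight w := w.length
  size_le w := by induction w <;> simp_all

section weight

variable {α β : Type} [Coded α] [Coded β]

theorem weight_prod (x : α × β) : weight x = weight x.1 + weight x.2 + 2 := rfl

theorem weight_nil : weight ([] : List α) = 0 := rfl

theorem weight_cons (a : α) (l : List α) : weight (a :: l) = weight a + 2 + weight l := by
  simp [weight]

theorem weight_append (l m : List α) : weight (l ++ m) = weight l + weight m := by
  simp [weight]

theorem weight_add_two_le {a : α} {l : List α} (h : a ∈ l) : weight a + 2 ≤ weight l :=
  List.le_sum_of_mem (List.mem_map_of_mem h)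

/-- Even an empty entry contributes its two brackets. Hence the number of answer tuples is bounded
by the output length also when the tuples are empty. -/
theorem two_mul_length_le (l : List α) : 2 * l.length ≤ weight l := by
  induction l with
  | nil => simp
  | cons a l ih => rw [weight_cons]; simp; omega

theorem weight_le_of_sublist {l m : List α} (h : l.Sublist m) : weight l ≤ weight m :=
  List.Sublist.sum_le_sum (h.map _) (by simp)

theorem weight_le_mul {l : List α} {n : ℕ} (h : ∀ a ∈ l, weight a ≤ n) :
    weight l ≤ l.length * (n + 2) := by
  induction l with
  | nil => simp [weight_nil]
  | cons a l ih =>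
    have h₁ := ih fun b hb => h b (List.mem_cons_of_mem _ hb)
    have h₂ := h a List.mem_cons_self
    rw [weight_cons, List.length_cons, add_mul]
    omega

end weight

theorem weight_flatMap_le {α β : Type} [Coded β] {l : List α} {f : α → List β} {n : ℕ}
    (h : ∀ a ∈ l, weight (f a) ≤ n) :
    weight (l.flatMap f) ≤ l.length * n := by
  induction l with
  | nil => simp [weight_nil]
  | cons a l ih =>
    have h₁ := ih fun b hb => h b (List.mem_cons_of_mem _ hb)
    have h₂ := h a List.mem_cons_self
    rw [List.flatMap_cons, weight_append, List.length_cons, add_mul]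
    omega

theorem toData_word_injective : Function.Injective (toData : List Bool → Data) := by
  intro w
  induction w with
  | nil => intro w' h; cases w' <;> simp_all [toData]
  | cons b w ih =>
    intro w' h
    cases w' with
    | nil => simp [toData] at h
    | cons b' w' =>
      simp only [toData, List.foldr_cons, Data.bit.injEq] at h
      rw [h.1, ih h.2]

theorem toData_list_injective {α : Type} [Coded α] (hα : Function.Injective (toData : α → Data)) :
    Function.Injective (toData : List α → Data) := by
  intro l
  induction l with
  | nil => intro l' h; cases l' <;> simp_all [toData]
  | cons a l ih =>
    intro l' h
    cases l' with
    | nil => simp [toData] at h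
    | cons a' l' =>
      simp only [toData, List.foldr_cons, Data.node.injEq] at h
      rw [hα h.1, ih h.2]

/-- The coefficients are natural numbers, so every term is monotone. -/
theorem eval_mono (p : Polynomial ℕ) {m n : ℕ} (h : m ≤ n) : p.eval m ≤ p.eval n := by
  simp only [Polynomial.eval_eq_sum, Polynomial.sum]
  exact Finset.sum_le_sum fun i _ => Nat.mul_le_mul_left _ (Nat.pow_le_pow_left h i)

/-- The function `f` is computed by a program whose running time, as well as the weight of its
result, is bounded by a polynomial in the weight of the argument. -/
def PolyTime {γ α : Type} [Coded γ] [Coded α] (f : γ → α) : Prop :=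
  ∃ (P : Prog) (p : Polynomial ℕ), ∀ c, weight (f c) ≤ p.eval (weight c) ∧
    ∀ s, Exec P (p.eval (weight c)) (.idle (toData c).enc s) (.idle (toData (f c)).enc s)

/-- The predicate `p` is decided in polynomial time. -/
def PolyDec {γ : Type} [Coded γ] (p : γ → Bool) : Prop :=
  PolyTime fun c => [p c]

namespace PolyTime

variable {γ α β δ : Type} [Coded γ] [Coded α] [Coded β] [Coded δ]

/-- Only the tree is visible to a program, so a change of type that keeps the tree costs nothing. -/
theorem recode {f : γ → α} {g : γ → β} (hf : PolyTime f)
    (h : ∀ c, toData (g c) = toData (f c)) (hw : ∀ c, weight (g c) ≤ weight (f c)) :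
    PolyTime g := by
  obtain ⟨P, p, hp⟩ := hf
  refine ⟨P, p, fun c => ⟨(hw c).trans (hp c).1, fun s => ?_⟩⟩
  rw [h]
  exact (hp c).2 s

protected theorem id : PolyTime fun c : γ => c :=
  ⟨.skip, .X + 1, fun c => ⟨by simp, fun s => .skip (by simp)⟩⟩

theorem comp {f : γ → α} {g : α → β} (hg : PolyTime g) (hf : PolyTime f) :
    PolyTime fun c => g (f c) := by
  obtain ⟨P, p, hp⟩ := hf
  obtain ⟨Q, q, hq⟩ := hg
  refine ⟨P ;; Q, p + q.comp p, fun c => ?_⟩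
  have h₁ := eval_mono q (hp c).1
  simp only [Polynomial.eval_add, Polynomial.eval_comp]
  exact ⟨((hq _).1.trans h₁).trans (Nat.le_add_left _ _),
    fun s => .seq ((hp c).2 s) ((hq _).2 s) (by omega)⟩

theorem const (a : α) : PolyTime fun _ : γ => a := by
  refine ⟨clear .acc ;; pushAll (toData a).enc,
    2 * .X + ((toData a).enc.length + weight a + 2 : ℕ), fun c => ?_⟩
  have := Coded.size_le c
  simp only [Polynomial.eval_add, Polynomial.eval_mul, Polynomial.eval_X, Polynomial.eval_ofNat,
    Polynomial.eval_natCast, Nat.cast_id]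
  refine ⟨by omega, fun s => .seq (exec_clear_acc _ _ _ _ _)
    (by simpa using exec_pushAll (toData a).enc [] s) ?_⟩
  simp only [Data.size] at this
  omega

theorem pair {f : γ → α} {g : γ → β} (hf : PolyTime f) (hg : PolyTime g) :
    PolyTime fun c => (f c, g c) := by
  obtain ⟨P, p, hp⟩ := hf
  obtain ⟨Q, q, hq⟩ := hg
  -- One `p` pays for running `P`; the other eleven pay for moving its result, whose size is also
  -- bounded by `p`.
  refine ⟨Prog.pair P Q, 12 * p + q + 12 * .X + 27, fun c => ?_⟩
  have h₁ := Coded.size_le c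
  have h₂ := Coded.size_le (f c)
  have h₃ := (hp c).1
  have h₄ := (hq c).1
  simp only [Polynomial.eval_add, Polynomial.eval_mul, Polynomial.eval_X, Polynomial.eval_ofNat]
  refine ⟨by rw [weight_prod]; dsimp only; omega,
    fun s => (exec_pair (hp c).2 (hq c).2 s).mono (by omega)⟩

protected theorem fst : PolyTime fun x : α × β => x.1 := by
  refine ⟨Prog.fst, 7 * .X + 12, fun c => ?_⟩
  have h₁ := Coded.size_le c.1
  have h₂ := Coded.size_le c.2
  simp only [Polynomial.eval_add, Polynomial.eval_mul, Polynomial.eval_X, Polynomial.eval_ofNat,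
    weight_prod]
  exact ⟨by omega, fun s => (exec_fst _ _ s).mono (by omega)⟩

protected theorem snd : PolyTime fun x : α × β => x.2 := by
  refine ⟨Prog.snd, 7 * .X + 11, fun c => ?_⟩
  have h₁ := Coded.size_le c.1
  simp only [Polynomial.eval_add, Polynomial.eval_mul, Polynomial.eval_X, Polynomial.eval_ofNat,
    weight_prod]
  exact ⟨by omega, fun s => (exec_snd _ _ s).mono (by omega)⟩

theorem cons {f : γ → α} {g : γ → List α} (hf : PolyTime f) (hg : PolyTime g) :
    PolyTime fun c => f c :: g c :=
  (hf.pair hg).recode (fun _ => rfl) fun _ => by rw [weight_cons, weight_prod]; dsimp; omega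

theorem head {w : γ → List (List Bool)} (hw : PolyTime w) : PolyTime fun c => (w c).headD [] := by
  refine comp (g := fun l : List (List Bool) => l.headD []) ⟨Prog.fst, 7 * .X + 12, fun l => ?_⟩ hw
  simp only [Polynomial.eval_add, Polynomial.eval_mul, Polynomial.eval_X, Polynomial.eval_ofNat]
  cases l with
  | nil => exact ⟨Nat.zero_le _, fun s => (exec_fst_nil s).mono (by omega)⟩
  | cons a l =>
    have h₁ := Coded.size_le a
    have h₂ := Coded.size_le l
    rw [weight_cons]
    exact ⟨by simp only [List.headD_cons]; omega,
      fun s => (exec_fst (toData a) (toData l) s).mono (by omega)⟩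

theorem tail {l : γ → List α} (hl : PolyTime l) : PolyTime fun c => (l c).tail := by
  refine comp (g := fun l : List α => l.tail) ⟨Prog.snd, 7 * .X + 11, fun l => ?_⟩ hl
  simp only [Polynomial.eval_add, Polynomial.eval_mul, Polynomial.eval_X, Polynomial.eval_ofNat]
  cases l with
  | nil => exact ⟨Nat.zero_le _, fun s => (exec_snd_nil s).mono (by omega)⟩
  | cons a l =>
    have h₁ := Coded.size_le a
    rw [weight_cons]
    exact ⟨by simp only [List.tail_cons]; omega, fun s => (exec_snd _ _ s).mono (by omega)⟩

theorem toData_append (l m : List α) : toData (l ++ m) = (toData l).append (toData m) := by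
  induction l with
  | nil => rfl
  | cons a l ih => exact congrArg (Data.node (toData a)) ih

theorem append {f g : γ → List α} (hf : PolyTime f) (hg : PolyTime g) :
    PolyTime fun c => f c ++ g c := by
  refine comp (g := fun x : List α × List α => x.1 ++ x.2)
    ⟨Prog.append, 7 * .X + 11, fun x => ?_⟩ (hf.pair hg)
  have h₁ := Coded.size_le x.1
  simp only [Polynomial.eval_add, Polynomial.eval_mul, Polynomial.eval_X, Polynomial.eval_ofNat,
    weight_prod, weight_append, toData_append]
  exact ⟨by omega, fun s => (exec_append _ _ s).mono (by omega)⟩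

theorem _root_.ConjQuery.PolyDec.cond {p : γ → Bool} {f g : γ → α} (hp : PolyDec p)
    (hf : PolyTime f) (hg : PolyTime g) : PolyTime fun c => bif p c then f c else g c := by
  have h := PolyTime.pair hp PolyTime.id
  obtain ⟨R, r, hr⟩ := h
  obtain ⟨P, p', hp'⟩ := hf
  obtain ⟨Q, q, hq⟩ := hg
  refine ⟨R ;; branch P Q, r + p' + q + 5, fun c => ?_⟩
  simp only [Polynomial.eval_add, Polynomial.eval_ofNat]
  have h₁ := (hp' c).1
  have h₂ := (hq c).1
  refine ⟨by cases p c <;> simp only [cond_true, cond_false] <;> omega, fun s => ?_⟩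
  have h := exec_branch (b := p c) (fun _ => (hp' c).2) (fun _ => (hq c).2) s
  rw [show toData (bif p c then f c else g c) =
    bif p c then toData (f c) else toData (g c) by cases p c <;> rfl]
  exact .seq ((hr c).2 s) h (by omega)

theorem _root_.ConjQuery.PolyDec.of_eq {f g : γ → α} {p : γ → Bool} (hf : PolyTime f)
    (hg : PolyTime g) (h : ∀ c, p c = true ↔ toData (f c) = toData (g c)) : PolyDec p := by
  obtain ⟨R, r, hr⟩ := hf.pair hg
  refine ⟨R ;; Prog.eq, 13 * r + 21, fun c => ?_⟩
  simp only [Polynomial.eval_add, Polynomial.eval_mul, Polynomial.eval_ofNat]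
  have h₁ := (hr c).1
  have h₂ := Coded.size_le (f c)
  have h₃ := Coded.size_le (g c)
  rw [weight_prod] at h₁
  dsimp only at h₁
  exact ⟨by simp [weight], fun s => .seq ((hr c).2 s) (exec_eq (h c) s) (by omega)⟩

/-- The bound `q` cannot be dispensed with: a polynomial-time body may double the state in each
round. With it, the body runs only on arguments of uniformly bounded weight, once per item. -/
theorem foldl_core {F : γ → List α × β} {g : β → α → β} (hF : PolyTime F)
    (hg : PolyTime fun x : α × β => g x.2 x.1) (q : Polynomial ℕ)
    (hq : ∀ c l, l <+: (F c).1 → weight (l.foldl g (F c).2) ≤ q.eval (weight c)) :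
    PolyTime fun c => (F c).1.foldl g (F c).2 := by
  obtain ⟨P, p, hp⟩ := hF
  obtain ⟨R, r, hr⟩ := hg
  refine ⟨P ;; fold R, p + (r.comp (p + q + 2) + 14) * p + 12 + q, fun c => ?_⟩
  simp only [Polynomial.eval_add, Polynomial.eval_mul, Polynomial.eval_ofNat, Polynomial.eval_comp]
  have h₁ := (hp c).1
  rw [weight_prod] at h₁
  refine ⟨(hq c _ List.prefix_rfl).trans (Nat.le_add_left _ _), fun s => ?_⟩
  have h := exec_fold toData toData g (p := R)
    (n := r.eval (p.eval (weight c) + q.eval (weight c) + 2)) (F c).1 (F c).2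
    (fun l₁ a l₂ e s => ((hr (a, l₁.foldl g (F c).2)).2 s).mono (eval_mono r ?_)) s
  · refine .seq ((hp c).2 s) h ?_
    have h₂ := Coded.size_le (F c).1
    have h₃ : (toData (F c).1).size ≤ p.eval (weight c) := by omega
    have h₄ := Nat.mul_le_mul_left (r.eval (p.eval (weight c) + q.eval (weight c) + 2) + 14) h₃
    change p.eval (weight c) + ((_ + 14) * (toData (F c).1).size + 12) ≤ _
    omega
  · have h₂ := hq c l₁ (e ▸ List.prefix_append _ _)
    have h₃ : weight a + 2 ≤ weight (F c).1 := weight_add_two_le (by simp [e])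
    rw [weight_prod]
    dsimp only
    omega

/-- A fold is computable in polynomial time if the weight of its intermediate results is bounded
by a polynomial. -/
theorem foldl {l : γ → List α} {b : γ → β} {f : γ → β → α → β} (hl : PolyTime l) (hb : PolyTime b)
    (hf : PolyTime fun x : α × γ × β => f x.2.1 x.2.2 x.1) (q : Polynomial ℕ)
    (hq : ∀ c l', l' <+: l c → weight (l'.foldl (f c) (b c)) ≤ q.eval (weight c)) :
    PolyTime fun c => (l c).foldl (f c) (b c) := by
  -- The context `c` is carried unchanged in the state, so that the body of the fold becomes a fixed
  -- function.
  have key : ∀ (c : γ) (l : List α) (b : β),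
      l.foldl (fun (s : γ × β) a => (s.1, f s.1 s.2 a)) (c, b) = (c, l.foldl (f c) b) := by
    intro c l
    induction l with
    | nil => intro b; rfl
    | cons a l ih => intro b; exact ih _
  have h := foldl_core (F := fun c => (l c, (c, b c)))
    (g := fun (s : γ × β) a => (s.1, f s.1 s.2 a)) (hl.pair (PolyTime.id.pair hb))
    ((PolyTime.fst.comp .snd).pair hf) (.X + q + 2) fun c l' h => by
      simp only [key, weight_prod, Polynomial.eval_add, Polynomial.eval_X, Polynomial.eval_ofNat]
      have := hq c l' h
      omega
  simp only [key] at h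
  exact PolyTime.snd.comp h

theorem flatMap {l : γ → List α} {f : γ → α → List β} (hl : PolyTime l)
    (hf : PolyTime fun x : α × γ => f x.2 x.1) : PolyTime fun c => (l c).flatMap (f c) := by
  have key : ∀ (c : γ) (l : List α) (b : List β),
      l.foldl (fun b a => b ++ f c a) b = b ++ l.flatMap (f c) := by
    intro c l
    induction l with
    | nil => simp
    | cons a l ih => simp [ih]
  obtain ⟨_, p, hp⟩ := id hl
  obtain ⟨_, r, hr⟩ := id hf
  have h := foldl (b := fun _ : γ => ([] : List β)) (f := fun c b a => b ++ f c a) hl (.const _)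
    (.append (.comp .snd .snd) (hf.comp (.pair .fst (.comp .fst .snd)))) (p * r.comp (p + .X + 2))
    fun c l' h => by
      simp only [key, List.nil_append, Polynomial.eval_add, Polynomial.eval_X,
        Polynomial.eval_ofNat, Polynomial.eval_mul, Polynomial.eval_comp]
      have h₁ := weight_le_of_sublist h.sublist
      have h₂ := two_mul_length_le l'
      have h₃ := (hp c).1
      refine (weight_flatMap_le fun a ha => ((hr (a, c)).1.trans (eval_mono r ?_))).trans
        (Nat.mul_le_mul_right _ (by omega))
      have := weight_add_two_le ha
      rw [weight_prod]
      dsimp only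
      omega
  simpa only [key, List.nil_append] using h

theorem map {l : γ → List α} {f : γ → α → β} (hl : PolyTime l)
    (hf : PolyTime fun x : α × γ => f x.2 x.1) : PolyTime fun c => (l c).map (f c) := by
  simpa only [List.map_eq_flatMap] using hl.flatMap (f := fun c a => [f c a]) (hf.cons (.const _))

theorem filter {l : γ → List α} {p : γ → α → Bool} (hl : PolyTime l)
    (hp : PolyDec fun x : α × γ => p x.2 x.1) : PolyTime fun c => (l c).filter (p c) := by
  have key : ∀ (p : α → Bool) (l : List α),
      l.flatMap (fun a => bif p a then [a] else []) = l.filter p := by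
    intro p l
    induction l with
    | nil => rfl
    | cons a l ih => rw [List.flatMap_cons, ih, List.filter_cons]; cases p a <;> rfl
  have h := hl.flatMap (f := fun c a => bif p c a then [a] else [])
    (hp.cond (.cons .fst (.const _)) (.const _))
  simpa only [key] using h

end PolyTime

namespace PolyDec

variable {γ α : Type} [Coded γ] [Coded α]

theorem comp {δ : Type} [Coded δ] {p : δ → Bool} {f : γ → δ} (hp : PolyDec p) (hf : PolyTime f) :
    PolyDec fun c => p (f c) :=
  PolyTime.comp (g := fun d => [p d]) hp hf

protected theorem not {p : γ → Bool} (hp : PolyDec p) : PolyDec fun c => !p c := by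
  have h := hp.cond (.const [false]) (.const [true])
  unfold PolyDec
  convert h using 2 with c
  dsimp only
  cases p c <;> rfl

protected theorem and {p q : γ → Bool} (hp : PolyDec p) (hq : PolyDec q) :
    PolyDec fun c => p c && q c := by
  have h := hp.cond hq (.const [false])
  unfold PolyDec
  convert h using 2 with c
  dsimp only
  cases p c <;> rfl

protected theorem or {p q : γ → Bool} (hp : PolyDec p) (hq : PolyDec q) :
    PolyDec fun c => p c || q c := by
  have h := hp.cond (.const [true]) hq
  unfold PolyDec
  convert h using 2 with c
  dsimp only
  cases p c <;> rfl

theorem isEmpty {l : γ → List α} (hl : PolyTime l) : PolyDec fun c => (l c).isEmpty := by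
  refine .of_eq hl (.const ([] : List α)) fun c => ?_
  cases l c <;> simp [toData]

theorem all {l : γ → List α} {p : γ → α → Bool} (hl : PolyTime l)
    (hp : PolyDec fun x : α × γ => p x.2 x.1) : PolyDec fun c => (l c).all (p c) := by
  have h := isEmpty (hl.filter (p := fun c a => !p c a) hp.not)
  unfold PolyDec at h ⊢
  convert h using 3 with c
  rw [Bool.eq_iff_iff]
  simp [List.isEmpty_iff]

theorem any {l : γ → List α} {p : γ → α → Bool} (hl : PolyTime l)
    (hp : PolyDec fun x : α × γ => p x.2 x.1) : PolyDec fun c => (l c).any (p c) := by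
  have h := (all (p := fun c a => !p c a) hl hp.not).not
  simpa only [← List.not_any_eq_all_not, Bool.not_not] using h

end PolyDec

open Coded (toData weight)

/-! ### The algorithm -/

/-- Whether a term is a constant. -/
def Term.isConst : Term → Bool
  | .var _ => false
  | .const _ => true

/-- The name of a variable or the value of a constant. -/
def Term.word : Term → Word
  | .var x => x
  | .const c => c

/-- A list of bindings of terms to values. -/
abbrev Bindings : Type := List (Term × Word)

/-- Two bindings agree unless they bind the same term to different values. -/
def agree (p q : Term × Word) : Bool :=
  !decide (p.1 = q.1) || decide (p.2 = q.2)

/-- Whether all bindings in one list agree with all bindings in another. -/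
def compatible (σ τ : Bindings) : Bool :=
  σ.all fun p => τ.all fun q => agree p q

/-- Whether each constant is bound to itself and each term to one value only. -/
def valid (σ : Bindings) : Bool :=
  (σ.all fun p => !p.1.isConst || decide (p.1.word = p.2)) && compatible σ σ

/-- The bindings of a list of terms to a list of values. -/
def bind (ts : List Term) (vs : List Word) : Bindings :=
  -- The state holds the values not yet used. The default `[]` is never reached on matching facts,
  -- where the two lists have equal length.
  (ts.foldl (fun (s : List Word × Bindings) t => (s.1.tail, s.2 ++ [(t, s.1.headD [])])) (vs, [])).2

/-- Whether an atom and a fact have the same relation name and the same arity. -/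
def matchable (A : Atom) (f : Fact) : Bool :=
  decide (A.rel = f.rel) && decide (A.args.length = f.args.length)

/-- The bindings of the arguments of an atom to those of a matching fact. -/
def matchings (F : List Fact) (A : Atom) : List Bindings :=
  (F.filter fun f => matchable A f).map fun f => bind A.args f.args

/-- The trivial relation and those of the atoms. -/
def relations (F : List Fact) (body : List Atom) : List (List Bindings) :=
  -- Joining with the trivial relation changes nothing, so `n`-fold joins also cover sets of fewer
  -- than `n` atoms.
  [[]] :: body.map fun A => matchings F A

/-- For any `n` of the given relations, the joint bindings that extend `base`. -/
def joins (rels : List (List Bindings)) (base : Bindings) : ℕ → List (List Bindings)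
  | 0 => [[base]]
  | n + 1 => (joins rels base n).flatMap fun G =>
      rels.map fun R => G.flatMap fun σ => R.map fun r => r ++ σ

/-- Removes the bindings that are not compatible with any member of some group. -/
def prune (W : List (List Bindings)) : List (List Bindings) :=
  W.map fun G => G.filter fun σ => W.all fun G' => G'.any fun τ => compatible σ τ

/-- Whether some bindings in each group survive repeated pruning. -/
def consistent (n : ℕ) (rels : List (List Bindings)) (base : Bindings) : Bool :=
  let W := (joins rels base n).map fun G => G.filter fun σ => valid σ
  -- The list of all bindings serves as a loop counter: a round that changes anything removes a
  -- binding, so this many rounds reach a fixed point.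
  (W.flatten.foldl (fun W _ => prune W) W).all fun G => !G.isEmpty

/-- Removes repetitions. -/
def dedup (l : List Word) : List Word :=
  l.foldl (fun m a => bif m.any (fun b => decide (b = a)) then m else a :: m) []

/-- The values that a term may have. -/
def candidates (dom : List Word) (t : Term) : List Word :=
  bif t.isConst then [t.word] else dedup dom

/-- The extensions of the given lists of bindings by a term that pass the consistency test. -/
def extend (n : ℕ) (rels : List (List Bindings)) (dom : List Word) (P : List Bindings) (t : Term) :
    List Bindings :=
  (P.flatMap fun b => (candidates dom t).map fun v => b ++ [(t, v)]).filter
    fun b => consistent n rels b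

/-- The list of bindings with which the enumeration starts. -/
def start (n : ℕ) (rels : List (List Bindings)) (dom : List Word) (head : List Term) :
    List Bindings :=
  -- Body variables take their values from facts, but a head variable outside the body has a value
  -- only if the universe is nonempty.
  bif consistent n rels [] && ((head.all fun t => t.isConst) || !dom.isEmpty) then [[]] else []

/-- The answer of a query, as a list of tuples. -/
def solve (n : ℕ) (Q : Query) (D : Database) : List (List Word) :=
  (Q.head.foldl (extend n (relations D.facts Q.body) D.dom)
    (start n (relations D.facts Q.body) D.dom Q.head)).map fun b => b.map fun p => p.2

/-! ### The running time of the algorithm -/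

instance : Coded Term where
  toData t := .bit t.isConst (toData t.word)
  weight t := weight t.word + 1
  size_le t := by simpa using Coded.size_le t.word

/-- A pair puts brackets around its first component only. The trailing `()` makes the argument list
a first component too, as the prescribed encoding of atoms requires. -/
instance : Coded Atom where
  toData A := toData (A.rel, A.args, ())
  weight A := weight (A.rel, A.args, ())
  size_le _ := Coded.size_le _

instance : Coded Fact where
  toData f := toData (f.rel, f.args, ())
  weight f := weight (f.rel, f.args, ())
  size_le _ := Coded.size_le _

theorem toData_term_injective : Function.Injective (toData : Term → Data) := by
  intro t t' h
  have h₁ : t.isConst = t'.isConst := (Data.bit.inj h).1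
  have h₂ : t.word = t'.word := toData_word_injective (Data.bit.inj h).2
  cases t <;> cases t' <;> simp_all [Term.isConst, Term.word]

section

variable {γ : Type} [Coded γ]

theorem PolyDec.isConst {t : γ → Term} (ht : PolyTime t) : PolyDec fun c => (t c).isConst := by
  refine PolyDec.comp (p := Term.isConst) ⟨Prog.headBit, 2 * .X + 3, fun t => ?_⟩ ht
  have h : (toData t.word).size + 1 ≤ weight t := by
    have := Coded.size_le t.word
    simp only [weight] at this ⊢
    omega
  simp only [Polynomial.eval_add, Polynomial.eval_mul, Polynomial.eval_X, Polynomial.eval_ofNat]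
  exact ⟨by simp [weight], fun s => (exec_headBit _ _ s).mono (by omega)⟩

theorem PolyTime.word {t : γ → Term} (ht : PolyTime t) : PolyTime fun c => (t c).word :=
  comp (g := Term.word) ⟨Prog.pop .acc, .X + 2, fun t => by
    simp only [Polynomial.eval_add, Polynomial.eval_X, Polynomial.eval_ofNat]
    exact ⟨by simp only [weight]; omega, fun s => (exec_pop _).mono (Nat.le_add_left _ _)⟩⟩ ht

theorem PolyDec.word_eq {f g : γ → Word} (hf : PolyTime f) (hg : PolyTime g) :
    PolyDec fun c => decide (f c = g c) :=
  .of_eq hf hg fun c => by rw [decide_eq_true_iff, toData_word_injective.eq_iff]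

/-- Replacing the entries by `()` turns the lists into unary numbers, which are compared as trees.
-/
theorem PolyDec.length_eq {α β : Type} [Coded α] [Coded β] {f : γ → List α} {g : γ → List β}
    (hf : PolyTime f) (hg : PolyTime g) : PolyDec fun c => decide ((f c).length = (g c).length) := by
  refine .of_eq (hf.map (f := fun _ _ => ()) (.const _)) (hg.map (f := fun _ _ => ()) (.const _))
    fun c => ?_
  rw [decide_eq_true_iff, (toData_list_injective fun _ _ _ => rfl).eq_iff]
  simp [List.map_const', List.replicate_inj]

theorem PolyDec.agree {p q : γ → Term × Word} (hp : PolyTime p) (hq : PolyTime q) :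
    PolyDec fun c => agree (p c) (q c) := by
  refine .or (.not (.of_eq (.comp .fst hp) (.comp .fst hq) fun c => ?_))
    (.word_eq (.comp .snd hp) (.comp .snd hq))
  rw [decide_eq_true_iff, toData_term_injective.eq_iff]

theorem PolyDec.compatible {σ τ : γ → Bindings} (hσ : PolyTime σ) (hτ : PolyTime τ) :
    PolyDec fun c => compatible (σ c) (τ c) :=
  .all hσ (.all (hτ.comp .snd) (.agree (.comp .fst .snd) .fst))

theorem PolyDec.valid {σ : γ → Bindings} (hσ : PolyTime σ) : PolyDec fun c => valid (σ c) :=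
  .and (.all hσ (.or (.not (.isConst (.comp .fst .fst)))
    (.word_eq (.word (.comp .fst .fst)) (.comp .snd .fst)))) (.compatible hσ hσ)

theorem PolyTime.bind {ts : γ → List Term} {vs : γ → List Word} (hts : PolyTime ts)
    (hvs : PolyTime vs) : PolyTime fun c => bind (ts c) (vs c) := by
  -- The unused values only shrink, so each round appends one binding whose value has weight at most
  -- `n`.
  have key : ∀ (l : List Term) (s : List Word × Bindings) (n : ℕ), weight s.1 ≤ n →
      weight (l.foldl (fun (s : List Word × Bindings) t =>
        (s.1.tail, s.2 ++ [(t, s.1.headD [])])) s) ≤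
      n + weight s.2 + (n + 2) * weight l + 2 := by
    intro l
    induction l with
    | nil => intro s n h; rw [List.foldl_nil, weight_prod]; omega
    | cons t l ih =>
      intro s n h
      have h₁ : weight s.1.tail ≤ n := (weight_le_of_sublist (List.tail_sublist _)).trans h
      have h₂ : weight (s.1.headD []) ≤ n := by
        cases h' : s.1 with
        | nil => exact Nat.zero_le _
        | cons a m => rw [h', weight_cons] at h; simp only [List.headD_cons]; omega
      refine (ih (s.1.tail, s.2 ++ [(t, s.1.headD [])]) n h₁).trans ?_
      simp only [weight_append, weight_cons, weight_prod, weight_nil]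
      nlinarith [Nat.zero_le (weight t), Nat.zero_le (n * weight t)]
  obtain ⟨_, p, hp⟩ := id hts
  obtain ⟨_, q, hq⟩ := id hvs
  refine .comp .snd (PolyTime.foldl (f := fun _ (s : List Word × Bindings) t =>
    (s.1.tail, s.2 ++ [(t, s.1.headD [])])) hts (hvs.pair (.const [])) ?_
    (q + (q + 2) * p + 2) fun c l' h => ?_)
  · exact .pair (.tail (.comp .fst (.comp .snd .snd))) (.append (.comp .snd (.comp .snd .snd))
      (.cons (.pair .fst (.head (.comp .fst (.comp .snd .snd)))) (.const [])))
  · have h₁ := weight_le_of_sublist h.sublist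
    have h₂ := Nat.mul_le_mul_left (q.eval (weight c) + 2) (h₁.trans (hp c).1)
    refine (key l' (vs c, []) _ (hq c).1).trans ?_
    simp only [Polynomial.eval_add, Polynomial.eval_mul, Polynomial.eval_ofNat, weight_nil]
    omega

theorem PolyTime.atomRel {A : γ → Atom} (hA : PolyTime A) : PolyTime fun c => (A c).rel :=
  .comp (g := fun x : Word × List Term × Unit => x.1) .fst
    (hA.recode (g := fun c => ((A c).rel, (A c).args, ())) (fun _ => rfl) fun _ => le_rfl)

theorem PolyTime.atomArgs {A : γ → Atom} (hA : PolyTime A) : PolyTime fun c => (A c).args :=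
  .comp (g := fun x : Word × List Term × Unit => x.2.1) (.comp .fst .snd)
    (hA.recode (g := fun c => ((A c).rel, (A c).args, ())) (fun _ => rfl) fun _ => le_rfl)

theorem PolyTime.factRel {f : γ → Fact} (hf : PolyTime f) : PolyTime fun c => (f c).rel :=
  .comp (g := fun x : Word × List Word × Unit => x.1) .fst
    (hf.recode (g := fun c => ((f c).rel, (f c).args, ())) (fun _ => rfl) fun _ => le_rfl)

theorem PolyTime.factArgs {f : γ → Fact} (hf : PolyTime f) : PolyTime fun c => (f c).args :=
  .comp (g := fun x : Word × List Word × Unit => x.2.1) (.comp .fst .snd)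
    (hf.recode (g := fun c => ((f c).rel, (f c).args, ())) (fun _ => rfl) fun _ => le_rfl)

theorem PolyTime.matchings {F : γ → List Fact} {A : γ → Atom} (hF : PolyTime F) (hA : PolyTime A) :
    PolyTime fun c => matchings (F c) (A c) :=
  .map (hF.filter (.and (.word_eq (.atomRel (hA.comp .snd)) (.factRel .fst))
      (.length_eq (.atomArgs (hA.comp .snd)) (.factArgs .fst))))
    (.bind (.atomArgs (hA.comp .snd)) (.factArgs .fst))

theorem PolyTime.relations {F : γ → List Fact} {body : γ → List Atom} (hF : PolyTime F)
    (hb : PolyTime body) : PolyTime fun c => relations (F c) (body c) :=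
  .cons (.const _) (hb.map (.matchings (hF.comp .snd) .fst))

/-- The induction composes one more polynomial for each of the `n` levels. This is where the width
has to be fixed. -/
theorem PolyTime.joins {rels : γ → List (List Bindings)} {base : γ → Bindings}
    (hr : PolyTime rels) (hb : PolyTime base) (n : ℕ) :
    PolyTime fun c => joins (rels c) (base c) n := by
  induction n with
  | zero => exact .cons (.cons hb (.const [])) (.const [])
  | succ n ih =>
    exact ih.flatMap (.map (hr.comp .snd) (.flatMap (.comp .fst .snd)
      (.map (.comp .fst .snd) (.append .fst (.comp .fst .snd)))))

theorem PolyTime.prune {W : γ → List (List Bindings)} (hW : PolyTime W) :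
    PolyTime fun c => prune (W c) :=
  hW.map (.filter .fst (.all (hW.comp (.comp .snd .snd))
    (.any .fst (.compatible (.comp .fst (.comp .snd .snd)) .fst))))

theorem weight_prune_le (W : List (List Bindings)) : weight (prune W) ≤ weight W := by
  have key : ∀ (p : Bindings → Bool) (W : List (List Bindings)),
      weight (W.map fun G => G.filter p) ≤ weight W := by
    intro p W
    induction W with
    | nil => exact le_rfl
    | cons G W ih =>
      have := weight_le_of_sublist (List.filter_sublist (p := p) (l := G))
      rw [List.map_cons, weight_cons, weight_cons]
      omega
  exact key _ _

theorem PolyDec.consistent {rels : γ → List (List Bindings)} {base : γ → Bindings}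
    (hr : PolyTime rels) (hb : PolyTime base) (n : ℕ) :
    PolyDec fun c => consistent n (rels c) (base c) := by
  have hW : PolyTime fun c =>
      (ConjQuery.joins (rels c) (base c) n).map fun G => G.filter fun σ => ConjQuery.valid σ :=
    (hr.joins hb n).map (.filter .fst (.valid .fst))
  -- Pruning never increases the weight, which is the growth condition for iterating it.
  have key : ∀ (l : List Bindings) (W : List (List Bindings)),
      weight (l.foldl (fun W _ => ConjQuery.prune W) W) ≤ weight W := by
    intro l
    induction l with
    | nil => intro W; exact le_rfl
    | cons a l ih => intro W; exact (ih _).trans (weight_prune_le W)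
  have hfl : PolyTime fun c => ((ConjQuery.joins (rels c) (base c) n).map fun G =>
      G.filter fun σ => ConjQuery.valid σ).flatten := by
    simpa only [List.flatMap_id'] using hW.flatMap (f := fun _ G => G) .fst
  obtain ⟨_, p, hp⟩ := id hW
  exact .all (.foldl (f := fun _ W _ => ConjQuery.prune W) hfl hW (.prune (.comp .snd .snd)) p
    fun c l' _ => (key _ _).trans (hp c).1) (.not (.isEmpty .fst))

theorem PolyTime.dedup {l : γ → List Word} (hl : PolyTime l) : PolyTime fun c => dedup (l c) := by
  have key : ∀ (l m : List Word),
      weight (l.foldl (fun m a => bif m.any (fun b => decide (b = a)) then m else a :: m) m) ≤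
        weight m + weight l := by
    intro l
    induction l with
    | nil => intro m; exact le_rfl
    | cons a l ih =>
      intro m
      have h : ∀ b : Bool, weight (bif b then m else a :: m) ≤ weight m + (weight a + 2) := by
        rintro (_ | _)
        · rw [cond_false, weight_cons]; omega
        · exact Nat.le_add_right _ _
      refine (ih _).trans ?_
      rw [weight_cons, ← Nat.add_assoc]
      exact Nat.add_le_add_right (h _) _
  obtain ⟨_, p, hp⟩ := id hl
  refine .foldl (f := fun _ m a => bif m.any (fun b => decide (b = a)) then m else a :: m)
    hl (.const []) ?_ p fun c l' h => (key l' []).trans ?_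
  · exact PolyDec.cond (.any (.comp .snd .snd) (.word_eq .fst (.comp .fst .snd))) (.comp .snd .snd)
      (.cons .fst (.comp .snd .snd))
  · rw [weight_nil, Nat.zero_add]
    exact (weight_le_of_sublist h.sublist).trans (hp c).1

theorem PolyTime.candidates {dom : γ → List Word} {t : γ → Term} (hd : PolyTime dom)
    (ht : PolyTime t) : PolyTime fun c => candidates (dom c) (t c) :=
  PolyDec.cond (.isConst ht) (.cons (.word ht) (.const [])) (.dedup hd)

theorem PolyTime.extend {rels : γ → List (List Bindings)} {dom : γ → List Word}
    {P : γ → List Bindings} {t : γ → Term} (hr : PolyTime rels) (hd : PolyTime dom)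
    (hP : PolyTime P) (ht : PolyTime t) (n : ℕ) :
    PolyTime fun c => extend n (rels c) (dom c) (P c) (t c) :=
  .filter (hP.flatMap (.map (.candidates (hd.comp .snd) (ht.comp .snd))
      (.append (.comp .fst .snd) (.cons (.pair (ht.comp (.comp .snd .snd)) .fst) (.const [])))))
    (.consistent (hr.comp .snd) .fst n)

theorem PolyTime.start {rels : γ → List (List Bindings)} {dom : γ → List Word}
    {head : γ → List Term} (hr : PolyTime rels) (hd : PolyTime dom) (hh : PolyTime head) (n : ℕ) :
    PolyTime fun c => start n (rels c) (dom c) (head c) :=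
  PolyDec.cond
    (.and (.consistent hr (.const _) n) (.or (.all hh (.isConst .fst)) (.not (.isEmpty hd))))
    (.const _) (.const _)

end

/-! ### Pruning -/

theorem agree_iff {p q : Term × Word} : agree p q = true ↔ (p.1 = q.1 → p.2 = q.2) := by
  simp [agree, imp_iff_not_or]

theorem compatible_iff {σ τ : Bindings} :
    compatible σ τ = true ↔ ∀ p ∈ σ, ∀ q ∈ τ, p.1 = q.1 → p.2 = q.2 := by
  simp only [compatible, List.all_eq_true, agree_iff]

theorem valid_iff {σ : Bindings} :
    valid σ = true ↔ (∀ p ∈ σ, p.1.isConst = true → p.1.word = p.2) ∧ compatible σ σ = true := by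
  rw [valid, Bool.and_eq_true, List.all_eq_true]
  refine and_congr_left fun _ => forall₂_congr fun p _ => ?_
  rw [Bool.or_eq_true, decide_eq_true_iff]
  cases p.1.isConst
  · exact ⟨fun _ h => absurd h Bool.false_ne_true, fun _ => .inl rfl⟩
  · exact ⟨fun h _ => h.resolve_left Bool.false_ne_true, fun h => .inr (h rfl)⟩

theorem flatten_map_filter {α : Type} (p : α → Bool) (W : List (List α)) :
    (W.map fun G => G.filter p).flatten = W.flatten.filter p := by
  induction W with
  | nil => rfl
  | cons G W ih => rw [List.map_cons, List.flatten_cons, List.flatten_cons, List.filter_append, ih]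

theorem prune_eq_or_length_lt (W : List (List Bindings)) :
    prune W = W ∨ (prune W).flatten.length < W.flatten.length := by
  by_cases h : ∀ σ ∈ W.flatten, (W.all fun G' => G'.any fun τ => compatible σ τ) = true
  · left
    conv_rhs => rw [← List.map_id W]
    refine List.map_congr_left fun G hG => List.filter_eq_self.2 fun σ hσ => ?_
    exact h σ (List.mem_flatten.2 ⟨G, hG, hσ⟩)
  · right
    push Not at h
    obtain ⟨σ, hσ, h⟩ := h
    rw [prune, flatten_map_filter]
    exact List.length_filter_lt_length_iff_exists.2 ⟨σ, hσ, h⟩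

/-- Each round either changes nothing or lowers the number of bindings, so `n` rounds suffice for at
most `n` bindings. -/
theorem prune_iterate (n : ℕ) (W : List (List Bindings)) (h : W.flatten.length ≤ n) :
    prune (prune^[n] W) = prune^[n] W := by
  induction n generalizing W with
  | zero =>
    rcases prune_eq_or_length_lt W with h' | h'
    · exact h'
    · omega
  | succ n ih =>
    rw [Function.iterate_succ_apply]
    rcases prune_eq_or_length_lt W with h' | h'
    · rw [h', Function.iterate_fixed h', h']
    · exact ih _ (by omega)

/-- The test for deleting a binding does not depend on the group that contains it, so a single
predicate describes all survivors. A pairwise compatible family `g` represented in every group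
always supplies the partners that its members need, and so is never touched. -/
theorem prune_iterate_eq_filter (W : List (List Bindings)) (n : ℕ) :
    ∃ p : Bindings → Bool, (prune^[n] W = W.map fun G => G.filter p) ∧
      ∀ g : Bindings → Prop, (∀ G ∈ W, ∃ σ ∈ G, g σ) →
        (∀ σ τ, g σ → g τ → compatible σ τ = true) → ∀ σ, g σ → p σ = true := by
  induction n with
  | zero => exact ⟨fun _ => true, by simp, fun _ _ _ _ _ => rfl⟩
  | succ n ih =>
    obtain ⟨p, hp, hg⟩ := ih
    refine ⟨fun σ => p σ && (W.map fun G => G.filter p).all fun G' =>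
      G'.any fun τ => compatible σ τ, ?_, fun g h₁ h₂ σ hσ => ?_⟩
    · rw [Function.iterate_succ_apply', hp, prune, List.map_map]
      refine List.map_congr_left fun G _ => ?_
      simp only [Function.comp, List.filter_filter, Bool.and_comm]
    · simp only [Bool.and_eq_true, List.all_eq_true, List.any_eq_true, List.mem_map,
        forall_exists_index, and_imp, forall_apply_eq_imp_iff₂, List.mem_filter]
      refine ⟨hg g h₁ h₂ σ hσ, fun G hG => ?_⟩
      obtain ⟨τ, hτ, hgτ⟩ := h₁ G hG
      exact ⟨τ, ⟨hτ, hg g h₁ h₂ τ hgτ⟩, h₂ σ τ hσ hgτ⟩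

/-- The joint bindings that are tested for consistency. -/
def validJoins (n : ℕ) (rels : List (List Bindings)) (base : Bindings) : List (List Bindings) :=
  (joins rels base n).map fun G => G.filter fun σ => valid σ

theorem consistent_eq (n : ℕ) (rels : List (List Bindings)) (base : Bindings) :
    consistent n rels base =
      (prune^[(validJoins n rels base).flatten.length] (validJoins n rels base)).all
        fun G => !G.isEmpty := by
  rw [← List.foldl_const]
  rfl

theorem consistent_of_forall {n : ℕ} {rels : List (List Bindings)} {base : Bindings}
    {g : Bindings → Prop} (h₁ : ∀ G ∈ validJoins n rels base, ∃ σ ∈ G, g σ)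
    (h₂ : ∀ σ τ, g σ → g τ → compatible σ τ = true) : consistent n rels base = true := by
  obtain ⟨p, hp, hg⟩ := prune_iterate_eq_filter (validJoins n rels base)
    (validJoins n rels base).flatten.length
  simp only [consistent_eq, hp, List.all_eq_true, List.mem_map, forall_exists_index, and_imp,
    forall_apply_eq_imp_iff₂, Bool.not_eq_true', List.isEmpty_eq_false_iff_exists_mem,
    List.mem_filter]
  intro G hG
  obtain ⟨σ, hσ, h⟩ := h₁ G hG
  exact ⟨σ, hσ, hg g h₁ h₂ σ h⟩

/-- At the fixed point the pruning test deletes nothing, which says precisely that every survivor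
has a compatible survivor in each group. -/
theorem exists_of_consistent {n : ℕ} {rels : List (List Bindings)} {base : Bindings}
    (h : consistent n rels base = true) :
    ∃ p : Bindings → Prop, (∀ G ∈ validJoins n rels base, ∃ σ ∈ G, p σ) ∧
      ∀ G ∈ validJoins n rels base, ∀ σ ∈ G, p σ →
        ∀ G' ∈ validJoins n rels base, ∃ τ ∈ G', p τ ∧ compatible σ τ = true := by
  obtain ⟨p, hp, -⟩ := prune_iterate_eq_filter (validJoins n rels base)
    (validJoins n rels base).flatten.length
  have hfix := prune_iterate _ (validJoins n rels base) le_rfl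
  simp only [consistent_eq, hp, List.all_eq_true, List.mem_map, forall_exists_index, and_imp,
    forall_apply_eq_imp_iff₂, Bool.not_eq_true', List.isEmpty_eq_false_iff_exists_mem,
    List.mem_filter] at h
  refine ⟨fun σ => p σ = true, h, fun G hG σ hσ hpσ G' hG' => ?_⟩
  rw [hp, prune] at hfix
  have h₁ := (List.map_eq_map_iff.1 (hfix.trans (List.map_id _).symm)) (G.filter p)
    (List.mem_map_of_mem hG)
  have h₂ := List.filter_eq_self.1 h₁ σ (List.mem_filter.2 ⟨hσ, hpσ⟩)
  simp only [List.all_eq_true, List.mem_map, forall_exists_index, and_imp,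
    forall_apply_eq_imp_iff₂, List.any_eq_true, List.mem_filter] at h₂
  obtain ⟨τ, hτ, h₃⟩ := h₂ G' hG'
  exact ⟨τ, hτ.1, hτ.2, h₃⟩

/-- One group collects exactly the joins of the chosen relations `Rs`; by construction its members
contain a row of each of them. -/
theorem exists_mem_joins {rels : List (List Bindings)} {base : Bindings}
    (Rs : List (List Bindings)) (h : ∀ R ∈ Rs, R ∈ rels) :
    ∃ G ∈ joins rels base Rs.length, ∀ σ ∈ G, base ⊆ σ ∧ ∀ R ∈ Rs, ∃ r ∈ R, r ⊆ σ := by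
  induction Rs with
  | nil => exact ⟨[base], by simp [joins], by simp⟩
  | cons R Rs ih =>
    obtain ⟨G, hG, h'⟩ := ih fun R' hR' => h R' (List.mem_cons_of_mem _ hR')
    refine ⟨_, List.mem_flatMap.2 ⟨G, hG, List.mem_map.2 ⟨R, h R List.mem_cons_self, rfl⟩⟩,
      fun σ hσ => ?_⟩
    simp only [List.mem_flatMap, List.mem_map] at hσ
    obtain ⟨σ', hσ', r, hr, rfl⟩ := hσ
    refine ⟨fun q hq => List.mem_append_right _ ((h' σ' hσ').1 hq), fun R' hR' => ?_⟩
    rcases List.mem_cons.1 hR' with rfl | hR'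
    · exact ⟨r, hr, fun q hq => List.mem_append_left _ hq⟩
    · obtain ⟨r', hr', hsub⟩ := (h' σ' hσ').2 R' hR'
      exact ⟨r', hr', fun q hq => List.mem_append_right _ (hsub hq)⟩

theorem exists_mem_of_mem_joins {rels : List (List Bindings)} {base : Bindings}
    {P : Term × Word → Prop} (hb : ∀ q ∈ base, P q) (hr : ∀ R ∈ rels, ∃ r ∈ R, ∀ q ∈ r, P q)
    (n : ℕ) : ∀ G ∈ joins rels base n, ∃ σ ∈ G, ∀ q ∈ σ, P q := by
  induction n with
  | zero => simpa [joins] using hb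
  | succ n ih =>
    intro G hG
    simp only [joins, List.mem_flatMap, List.mem_map] at hG
    obtain ⟨G', hG', R, hR, rfl⟩ := hG
    obtain ⟨σ, hσ, h₁⟩ := ih G' hG'
    obtain ⟨r, hr', h₂⟩ := hr R hR
    refine ⟨r ++ σ, List.mem_flatMap.2 ⟨σ, hσ, List.mem_map_of_mem hr'⟩, fun q hq => ?_⟩
    exact (List.mem_append.1 hq).elim (h₂ q) (h₁ q)

theorem bind_eq_zip {ts : List Term} {vs : List Word} (h : ts.length = vs.length) :
    bind ts vs = ts.zip vs := by
  have key : ∀ (ts : List Term) (vs : List Word) (acc : Bindings), ts.length = vs.length →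
      (ts.foldl (fun (s : List Word × Bindings) t => (s.1.tail, s.2 ++ [(t, s.1.headD [])]))
        (vs, acc)).2 = acc ++ ts.zip vs := by
    intro ts
    induction ts with
    | nil => simp
    | cons t ts ih =>
      intro vs acc h
      cases vs with
      | nil => simp at h
      | cons v vs =>
        rw [List.foldl_cons, List.tail_cons, List.headD_cons, ih _ _ (by simpa using h)]
        simp
  simpa [bind] using key ts vs [] h

/-- Nothing is checked yet about constants or repeated variables; that is left to `valid`. -/
theorem mem_matchings {F : List Fact} {A : Atom} {r : Bindings} :
    r ∈ matchings F A ↔ ∃ f ∈ F, A.rel = f.rel ∧ A.args.length = f.args.length ∧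
      r = A.args.zip f.args := by
  simp only [matchings, List.mem_map, List.mem_filter, matchable, Bool.and_eq_true,
    decide_eq_true_iff]
  constructor
  · rintro ⟨f, ⟨hf, h₁, h₂⟩, rfl⟩
    exact ⟨f, hf, h₁, h₂, bind_eq_zip h₂⟩
  · rintro ⟨f, hf, h₁, h₂, rfl⟩
    exact ⟨f, ⟨hf, h₁, h₂⟩, bind_eq_zip h₂⟩

theorem zip_map_self (ts : List Term) (θ : Word → Word) :
    ts.zip (ts.map (Term.subst θ)) = ts.map fun t => (t, t.subst θ) := by
  induction ts with
  | nil => rfl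
  | cons t ts ih => simp [ih]

/-- A solution passes the consistency test. -/
theorem consistent_of_solution {F : List Fact} {body : List Atom} {base : Bindings}
    {θ : Word → Word} (hθ : ∀ A ∈ body, A.subst θ ∈ F) (hb : ∀ q ∈ base, q.1.subst θ = q.2)
    (n : ℕ) : consistent n (relations F body) base = true := by
  -- The family to be preserved consists of the bindings that follow `θ`; any two of them agree
  -- because both take their values from `θ`.
  refine consistent_of_forall (g := fun σ => ∀ q ∈ σ, q.1.subst θ = q.2) ?_ ?_
  · intro G hG
    obtain ⟨G', hG', rfl⟩ := List.mem_map.1 hG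
    have hr : ∀ R ∈ relations F body, ∃ r ∈ R, ∀ q ∈ r, q.1.subst θ = q.2 := by
      intro R hR
      rcases List.mem_cons.1 hR with rfl | hR
      · exact ⟨[], by simp, by simp⟩
      · obtain ⟨A, hA, rfl⟩ := List.mem_map.1 hR
        refine ⟨_, mem_matchings.2 ⟨A.subst θ, hθ A hA, rfl, by simp [Atom.subst], rfl⟩, ?_⟩
        simp only [Atom.subst, zip_map_self, List.mem_map]
        rintro _ ⟨t, -, rfl⟩
        rfl
    obtain ⟨σ, hσ, h⟩ := exists_mem_of_mem_joins hb hr n G' hG'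
    refine ⟨σ, List.mem_filter.2 ⟨hσ, valid_iff.2 ⟨fun p hp hc => ?_, ?_⟩⟩, h⟩
    · have := h p hp
      cases h' : p.1 <;> simp_all [Term.subst, Term.word, Term.isConst]
    · exact compatible_iff.2 fun p hp q hq e => by rw [← h p hp, ← h q hq, e]
  · exact fun σ τ hσ hτ => compatible_iff.2 fun p hp q hq e => by rw [← hσ p hp, ← hτ q hq, e]

/-! ### Sections over trees -/

/-- Transports an element along a walk. -/
def follow {V : Type} {T : SimpleGraph V} {X : V → Type} (f : ∀ p q, T.Adj p q → X p → X q) :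
    {u v : V} → T.Walk u v → X u → X v
  | _, _, .nil, a => a
  | _, _, .cons h w, a => follow f w (f _ _ h a)

theorem follow_concat {V : Type} {T : SimpleGraph V} {X : V → Type}
    (f : ∀ p q, T.Adj p q → X p → X q) {u v w : V} (p : T.Walk u v) (h : T.Adj v w) (a : X u) :
    follow f (p.concat h) a = f _ _ h (follow f p a) := by
  induction p with
  | nil => rfl
  | cons h' p ih => exact ih h (f _ _ h' a)

/-- If elements can be transported along the edges of a tree, then the vertices can be labelled
in such a way that the labels of adjacent vertices are related by transport. -/
theorem exists_section {V : Type} {T : SimpleGraph V} (hT : T.IsTree) (root : V) {X : V → Type}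
    (f : ∀ p q, T.Adj p q → X p → X q) (a : X root) :
    ∃ s : ∀ p, X p, ∀ p q (h : T.Adj p q), s q = f p q h (s p) ∨ s p = f q p h.symm (s q) := by
  -- The label of a vertex is `a` transported along the path from the root.
  choose w hw using fun v => (hT.existsUnique_path root v).exists
  refine ⟨fun v => follow f (w v) a, fun p q h => ?_⟩
  -- Of two adjacent vertices one lies on the root path of the other, and the longer path is the
  -- shorter one extended by their edge.
  by_cases hp : p ∈ (w q).support
  · left
    dsimp only
    rw [hT.isAcyclic.path_concat (hw p) (hw q) h hp, follow_concat]
  · right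
    dsimp only
    have hq := hT.isAcyclic.mem_support_of_ne_mem_support_of_adj_of_isPath (hw p) (hw q) h hp
    rw [hT.isAcyclic.path_concat (hw q) (hw p) h.symm hq, follow_concat]

/-! ### Completeness of the consistency test for bounded hypertree width -/

theorem Term.mem_vars {x : Word} {t : Term} : x ∈ t.vars ↔ t = .var x := by
  cases t <;> simp [Term.vars, eq_comm]

theorem Atom.mem_vars {x : Word} {A : Atom} : x ∈ A.vars ↔ Term.var x ∈ A.args := by
  simp [Atom.vars, Term.mem_vars]

theorem mem_atomsVars {x : Word} {R : Finset Atom} :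
    x ∈ atomsVars R ↔ ∃ A ∈ R, Term.var x ∈ A.args := by
  simp [atomsVars, Atom.mem_vars]

theorem Query.mem_vars {x : Word} {Q : Query} :
    x ∈ Q.vars ↔ Term.var x ∈ Q.head ∨ ∃ A ∈ Q.body, Term.var x ∈ A.args := by
  simp [Query.vars, Term.mem_vars, mem_atomsVars, Query.atoms]

theorem exists_mem_zip {α β : Type} {l : List α} {m : List β} (h : l.length = m.length) {a : α}
    (ha : a ∈ l) : ∃ b, (a, b) ∈ l.zip m := by
  rw [← List.map_fst_zip (l₁ := l) (l₂ := m) h.le] at ha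
  obtain ⟨⟨a, b⟩, hab, rfl⟩ := List.mem_map.1 ha
  exact ⟨b, hab⟩

theorem map_eq_of_zip {α β : Type} {l : List α} {m : List β} (h : l.length = m.length) {f : α → β}
    (hf : ∀ p ∈ l.zip m, f p.1 = p.2) : l.map f = m := by
  rw [← List.map_fst_zip (l₁ := l) (l₂ := m) h.le, List.map_map]
  conv_rhs => rw [← List.map_snd_zip (l₁ := l) (l₂ := m) h.ge]
  exact List.map_congr_left hf

/-- Survivors chosen in the groups of the sets λ(v), compatible along the edges, determine all
variables in χ-labels. Every group contains `base`, so the resulting substitution respects it. The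
default `d` is left for variables that neither the body nor `base` mentions. -/
theorem exists_solution_of_consistent {Q : Query} {F : List Fact} {H : Hypertree Q}
    (hH : H.IsDecomposition) {n : ℕ} (hn : H.width < n) {base : Bindings}
    (h : consistent n (relations F Q.body) base = true) (d : Word) :
    ∃ θ : Word → Word, (∀ A ∈ Q.body, A.subst θ ∈ F) ∧ (∀ q ∈ base, q.1.subst θ = q.2) ∧
      ∀ x, (∀ A ∈ Q.body, Term.var x ∉ A.args) → (∀ v, (Term.var x, v) ∉ base) → θ x = d := by
  classical
  obtain ⟨p, hp, hforth⟩ := exists_of_consistent h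
  -- The surviving bindings, and those among them that extend matchings of a given set of atoms.
  let S : Set Bindings := {σ | p σ ∧ ∃ G ∈ validJoins n (relations F Q.body) base, σ ∈ G}
  let C : Finset Atom → Set Bindings := fun R =>
    {σ | σ ∈ S ∧ base ⊆ σ ∧ ∀ A ∈ R, ∃ r ∈ matchings F A, r ⊆ σ}
  have hvalid : ∀ σ ∈ S, valid σ = true := by
    rintro σ ⟨-, G, hG, hσ⟩
    obtain ⟨G', -, rfl⟩ := List.mem_map.1 hG
    exact (List.mem_filter.1 hσ).2
  have hgroup : ∀ R : Finset Atom, R ⊆ Q.atoms → R.card ≤ n →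
      ∃ G ∈ validJoins n (relations F Q.body) base, ∀ σ ∈ G, p σ → σ ∈ C R := by
    intro R hR hcard
    -- Padding with the trivial relation brings the number of relations to exactly `n`.
    let Rs := (R.toList.map fun A => matchings F A) ++ List.replicate (n - R.card) [[]]
    have hlen : Rs.length = n := by simp [Rs]; omega
    obtain ⟨G, hG, h⟩ := exists_mem_joins (rels := relations F Q.body) (base := base) Rs (by
      intro R' hR'
      rcases List.mem_append.1 hR' with h | h
      · obtain ⟨A, hA, rfl⟩ := List.mem_map.1 h
        exact List.mem_cons_of_mem _ (List.mem_map_of_mem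
          (List.mem_toFinset.1 (hR (Finset.mem_toList.1 hA))))
      · rw [List.eq_of_mem_replicate h]
        exact List.mem_cons_self)
    rw [hlen] at hG
    have hG' := List.mem_map_of_mem (f := fun G => G.filter fun σ => valid σ) hG
    refine ⟨_, hG', fun σ hσ hpσ => ⟨⟨hpσ, _, hG', hσ⟩, ?_⟩⟩
    have h' := h σ (List.mem_filter.1 hσ).1
    refine ⟨h'.1, fun A hA => h'.2 _ (List.mem_append_left _ (List.mem_map_of_mem ?_))⟩
    exact Finset.mem_toList.2 hA
  have hstep : ∀ R : Finset Atom, R ⊆ Q.atoms → R.card ≤ n → ∀ σ ∈ S,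
      ∃ τ ∈ C R, compatible σ τ = true := by
    rintro R hR hcard σ ⟨hpσ, G, hG, hσ⟩
    obtain ⟨G', hG', h'⟩ := hgroup R hR hcard
    obtain ⟨τ, hτ, hpτ, hc⟩ := hforth G hG σ hσ hpσ G' hG'
    exact ⟨τ, h' τ hτ hpτ, hc⟩
  have hcard : ∀ v, (H.lam v).card ≤ n := fun v =>
    (Finset.le_sup (f := fun p => (H.lam p).card) (Finset.mem_univ v)).trans hn.le
  -- A choice of bindings for the vertices, compatible along the edges.
  obtain ⟨s, hs, hadj⟩ : ∃ s : H.V → Bindings, (∀ v, s v ∈ C (H.lam v)) ∧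
      ∀ v w, H.T.Adj v w → compatible (s v) (s w) = true := by
    have hcomm : ∀ σ τ, compatible σ τ = true → compatible τ σ = true := fun σ τ h =>
      compatible_iff.2 fun p hp q hq e => (compatible_iff.1 h q hq p hp e.symm).symm
    choose f hf hf' using fun (w : H.V) (σ : Bindings) (hσ : σ ∈ S) =>
      hstep (H.lam w) (H.lam_subset w) (hcard w) σ hσ
    obtain ⟨G, hG, h'⟩ := hgroup (H.lam H.root) (H.lam_subset _) (hcard _)
    obtain ⟨σ, hσ, hpσ⟩ := hp G hG
    obtain ⟨s, hs⟩ := exists_section H.isTree H.root (X := fun v => C (H.lam v))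
      (fun v w _ σ => ⟨f w σ.1 σ.2.1, hf w σ.1 σ.2.1⟩) ⟨σ, h' σ hσ hpσ⟩
    refine ⟨fun v => (s v).1, fun v => (s v).2, fun v w hvw => ?_⟩
    rcases hs v w hvw with e | e
    · dsimp only
      rw [e]
      exact hf' _ _ _
    · dsimp only
      rw [e]
      exact hcomm _ _ (hf' _ _ _)
  have hself : ∀ v, compatible (s v) (s v) = true := fun v =>
    (valid_iff.1 (hvalid _ (hs v).1)).2
  have hval : ∀ v, ∀ x ∈ H.chi v, ∃ a, (Term.var x, a) ∈ s v := by
    intro v x hx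
    obtain ⟨A, hA, hxA⟩ := mem_atomsVars.1 (hH.chi_subset_lam v hx)
    obtain ⟨r, hr, hsub⟩ := (hs v).2.2 A hA
    obtain ⟨f, -, -, hlen, rfl⟩ := mem_matchings.1 hr
    obtain ⟨a, ha⟩ := exists_mem_zip hlen hxA
    exact ⟨a, hsub ha⟩
  -- Along a walk among vertices whose χ-label contains `x`, every vertex binds `x`, and
  -- compatibility passes the value from each vertex to the next.
  have huniq : ∀ x v w a b, x ∈ H.chi v → x ∈ H.chi w → (Term.var x, a) ∈ s v →
      (Term.var x, b) ∈ s w → a = b := by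
    intro x v w a b hv hw ha hb
    obtain ⟨q⟩ := hH.connected x (H.chi_subset v hv) ⟨v, hv⟩ ⟨w, hw⟩
    have key : ∀ (v w : {p | x ∈ H.chi p}) (_ : (H.T.induce {p | x ∈ H.chi p}).Walk v w) (a b),
        (Term.var x, a) ∈ s v → (Term.var x, b) ∈ s w → a = b := by
      intro v w q
      induction q with
      | nil => exact fun a b ha hb => compatible_iff.1 (hself _) _ ha _ hb rfl
      | @cons u v w h _ ih =>
        intro a b ha hb
        obtain ⟨c, hc⟩ := hval v x v.2
        exact (compatible_iff.1 (hadj u v h) _ ha _ hc rfl).trans (ih c b hc hb)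
    exact key _ _ q a b ha hb
  -- The solution.
  let θ : Word → Word := fun x =>
    if h : ∃ a v, x ∈ H.chi v ∧ (Term.var x, a) ∈ s v then h.choose
    else if h : ∃ a, (Term.var x, a) ∈ base then h.choose else d
  have hθ : ∀ x v a, x ∈ H.chi v → (Term.var x, a) ∈ s v → θ x = a := by
    intro x v a hx ha
    have h : ∃ a v, x ∈ H.chi v ∧ (Term.var x, a) ∈ s v := ⟨a, v, hx, ha⟩
    obtain ⟨w, hw, hb⟩ := h.choose_spec
    simp only [θ, dif_pos h]
    exact huniq x w v _ _ hw hx hb ha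
  have hconst : ∀ σ ∈ S, ∀ q ∈ σ, q.1.isConst = true → q.1.subst θ = q.2 := by
    intro σ hσ q hq hc
    rw [← (valid_iff.1 (hvalid σ hσ)).1 q hq hc]
    cases h : q.1 <;> simp_all [Term.isConst, Term.subst, Term.word]
  refine ⟨θ, fun A hA => ?_, fun q hq => ?_, fun x hx hb => ?_⟩
  · obtain ⟨v, hv⟩ := hH.cover A (List.mem_toFinset.2 hA)
    -- The atom `A` need not belong to λ(v), so its fact comes from a survivor in the group of `{A}`
    -- compatible with `s v`. This needs `1 ≤ n`, which the strict inequality `hn` provides even for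
    -- width zero.
    obtain ⟨τ, hτ, hc⟩ := hstep {A} (by simpa [Query.atoms] using hA) (by simp; omega) (s v) (hs v).1
    obtain ⟨r, hr, hsub⟩ := hτ.2.2 A (Finset.mem_singleton_self A)
    obtain ⟨f, hf, hrel, hlen, rfl⟩ := mem_matchings.1 hr
    have e : A.subst θ = f := by
      cases f with
      | mk rel args =>
        simp only [Atom.subst, Fact.mk.injEq]
        refine ⟨hrel, map_eq_of_zip hlen fun q hq => ?_⟩
        obtain ⟨t, b⟩ := q
        cases t with
        | const c => exact hconst τ hτ.1 _ (hsub hq) rfl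
        | var x =>
          have hx : x ∈ H.chi v := hv (Atom.mem_vars.2 (List.of_mem_zip hq).1)
          obtain ⟨a, ha⟩ := hval v x hx
          exact (hθ x v a hx ha).trans (compatible_iff.1 hc _ ha _ (hsub hq) rfl)
    rwa [e]
  · obtain ⟨t, b⟩ := q
    cases t with
    | const c => exact hconst _ (hs H.root).1 _ ((hs H.root).2.1 hq) rfl
    | var x =>
      by_cases h : ∃ a v, x ∈ H.chi v ∧ (Term.var x, a) ∈ s v
      · obtain ⟨a, v, hx, ha⟩ := h
        exact (hθ x v a hx ha).trans
          (compatible_iff.1 (hself v) _ ha _ ((hs v).2.1 hq) rfl)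
      -- The choice made in `θ` does not matter: the bindings at the root contain `base` and agree
      -- with one another, so `base` gives `x` one value only.
      · have h' : ∃ a, (Term.var x, a) ∈ base := ⟨b, hq⟩
        have hroot := (hs H.root).2.1
        simp only [Term.subst, θ, dif_neg h, dif_pos h']
        exact compatible_iff.1 (hself H.root) _ (hroot h'.choose_spec) _ (hroot hq) rfl
  · have h : ¬ ∃ a v, x ∈ H.chi v ∧ (Term.var x, a) ∈ s v := by
      rintro ⟨a, v, hv, -⟩
      obtain ⟨A, hA, hxA⟩ := mem_atomsVars.1 (hH.chi_subset_lam v hv)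
      exact hx A (List.mem_toFinset.1 (H.lam_subset v hA)) hxA
    simp only [θ, dif_neg h, dif_neg (not_exists.2 hb)]

open Coded (toData weight)

/-! ### The enumeration of the answer -/

/-- The substitutions that witness the answer of a query. -/
def IsSolution (Q : Query) (D : Database) (θ : Word → Word) : Prop :=
  (∀ x ∈ Q.vars, θ x ∈ D.dom) ∧ ∀ A ∈ Q.body, A.subst θ ∈ D.facts

/-- The bindings of terms to their values under a substitution. -/
def graph (θ : Word → Word) (l : List Term) : Bindings :=
  l.map fun t => (t, t.subst θ)

theorem graph_append_singleton (θ : Word → Word) (l : List Term) (t : Term) :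
    graph θ (l ++ [t]) = graph θ l ++ [(t, t.subst θ)] := by
  simp [graph]

/-- Values of body variables occur in facts, hence in the universe; those bound by `base` lie there
by assumption. A remaining variable occurs only in the head and receives the first element of the
universe. -/
theorem exists_isSolution {Q : Query} {D : Database} {n : ℕ} (h : Q.hypertreeWidth ≤ (n : ℕ∞))
    {base : Bindings} (hc : consistent (n + 1) (relations D.facts Q.body) base = true)
    (hbase : ∀ x v, (Term.var x, v) ∈ base → v ∈ D.dom)
    (hdom : ∀ x, Term.var x ∈ Q.head → D.dom ≠ []) :
    ∃ θ, IsSolution Q D θ ∧ ∀ q ∈ base, q.1.subst θ = q.2 := by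
  -- If every decomposition had width at least `n + 1`, so would the infimum.
  obtain ⟨H, hH, hw⟩ : ∃ H : Hypertree Q, H.IsDecomposition ∧ H.width < n + 1 := by
    by_contra! hcon
    have h' : ((n + 1 : ℕ) : ℕ∞) ≤ Q.hypertreeWidth :=
      le_iInf₂ fun H hH => Nat.cast_le.2 (hcon H hH)
    exact absurd (Nat.cast_le.1 (h'.trans h)) (by omega)
  obtain ⟨θ, hθ, hb, hd⟩ := exists_solution_of_consistent hH hw hc (D.dom.headD [])
  refine ⟨θ, ⟨fun x hx => ?_, hθ⟩, hb⟩
  by_cases hA : ∃ A ∈ Q.body, Term.var x ∈ A.args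
  · obtain ⟨A, hA, hxA⟩ := hA
    exact D.mem_dom _ (hθ A hA) _ (List.mem_map.2 ⟨_, hxA, rfl⟩)
  by_cases hv : ∃ v, (Term.var x, v) ∈ base
  · obtain ⟨v, hv⟩ := hv
    have e : θ x = v := hb _ hv
    exact e ▸ hbase x v hv
  · push Not at hA hv
    have hne := hdom x ((Query.mem_vars.1 hx).resolve_right fun ⟨A, hA', hxA⟩ => hA A hA' hxA)
    rw [hd x hA hv]
    cases h : D.dom with
    | nil => exact absurd h hne
    | cons a l => exact List.mem_cons_self

theorem dedup_spec (l : List Word) : (dedup l).Nodup ∧ ∀ a, a ∈ dedup l ↔ a ∈ l := by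
  have key : ∀ (l m : List Word), m.Nodup →
      (l.foldl (fun m a => bif m.any (fun b => decide (b = a)) then m else a :: m) m).Nodup ∧
      ∀ a, a ∈ l.foldl (fun m a => bif m.any (fun b => decide (b = a)) then m else a :: m) m ↔
        a ∈ m ∨ a ∈ l := by
    intro l
    induction l with
    | nil => intro m hm; simpa using hm
    | cons a l ih =>
      intro m hm
      rw [List.foldl_cons]
      by_cases h : a ∈ m
      · have h' : m.any (fun b => decide (b = a)) = true := by simpa using h
        rw [h', cond_true]
        refine ⟨(ih m hm).1, fun b => ?_⟩
        rw [(ih m hm).2, List.mem_cons]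
        constructor
        · tauto
        · rintro (h | rfl | h) <;> tauto
      · have h' : m.any (fun b => decide (b = a)) = false := by
          rw [← Bool.not_eq_true]
          simpa using h
        rw [h', cond_false]
        have hm' := List.nodup_cons.2 ⟨h, hm⟩
        refine ⟨(ih _ hm').1, fun b => ?_⟩
        rw [(ih _ hm').2, List.mem_cons, List.mem_cons]
        tauto
  simpa [dedup] using key l [] List.nodup_nil

theorem nodup_candidates (dom : List Word) (t : Term) : (candidates dom t).Nodup := by
  unfold candidates
  cases t.isConst
  · exact (dedup_spec dom).1
  · exact List.nodup_singleton _

theorem mem_candidates_var {dom : List Word} {x v : Word} :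
    v ∈ candidates dom (.var x) ↔ v ∈ dom :=
  (dedup_spec dom).2 v

theorem subst_mem_candidates {Q : Query} {D : Database} {θ : Word → Word}
    (hθ : IsSolution Q D θ) {t : Term} (ht : t ∈ Q.head) : t.subst θ ∈ candidates D.dom t := by
  cases t with
  | const c => exact List.mem_singleton_self c
  | var x => exact mem_candidates_var.2 (hθ.1 x (Query.mem_vars.2 (.inl ht)))

/-- The list of bindings obtained after some of the terms of the head have been bound. -/
def stage (n : ℕ) (Q : Query) (D : Database) (l : List Term) : List Bindings :=
  l.foldl (extend n (relations D.facts Q.body) D.dom)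
    (start n (relations D.facts Q.body) D.dom Q.head)

theorem mem_stage_nil {Q : Query} {D : Database} {n : ℕ} (h : Q.hypertreeWidth ≤ (n : ℕ∞))
    (b : Bindings) :
    b ∈ stage (n + 1) Q D [] ↔ b = [] ∧ ∃ θ, IsSolution Q D θ := by
  have key : (consistent (n + 1) (relations D.facts Q.body) [] &&
      ((Q.head.all fun t => t.isConst) || !D.dom.isEmpty)) = true ↔ ∃ θ, IsSolution Q D θ := by
    simp only [Bool.and_eq_true, Bool.or_eq_true, List.all_eq_true, Bool.not_eq_true',
      List.isEmpty_eq_false_iff]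
    constructor
    · rintro ⟨hc, hd⟩
      obtain ⟨θ, hθ, -⟩ := exists_isSolution h hc (by simp) fun x hx => hd.resolve_left fun hd =>
        Bool.false_ne_true (hd _ hx)
      exact ⟨θ, hθ⟩
    · rintro ⟨θ, hθ⟩
      refine ⟨consistent_of_solution hθ.2 (by simp) _, ?_⟩
      by_cases hd : D.dom = []
      · refine .inl fun t ht => ?_
        cases t with
        | const c => rfl
        | var x => simpa [hd] using hθ.1 x (Query.mem_vars.2 (.inl ht))
      · exact .inr hd
  rw [← key, stage, List.foldl_nil, start]
  cases (consistent (n + 1) (relations D.facts Q.body) [] &&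
      ((Q.head.all fun t => t.isConst) || !D.dom.isEmpty)) <;> simp

theorem stage_append_singleton (n : ℕ) (Q : Query) (D : Database) (l : List Term) (t : Term) :
    stage n Q D (l ++ [t]) = extend n (relations D.facts Q.body) D.dom (stage n Q D l) t := by
  simp [stage]

/-- The enumeration has no dead ends: a partial binding passes the test only if it extends to a
solution, possibly a different one from that which witnessed the previous stage. -/
theorem mem_stage {Q : Query} {D : Database} {n : ℕ} (h : Q.hypertreeWidth ≤ (n : ℕ∞))
    (l : List Term) (hl : l ⊆ Q.head) (b : Bindings) :
    b ∈ stage (n + 1) Q D l ↔ ∃ θ, IsSolution Q D θ ∧ b = graph θ l := by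
  induction l using List.reverseRecOn generalizing b with
  | nil =>
    rw [mem_stage_nil h]
    exact ⟨fun ⟨e, θ, hθ⟩ => ⟨θ, hθ, e⟩, fun ⟨θ, hθ, e⟩ => ⟨e, θ, hθ⟩⟩
  | append_singleton l t ih =>
    have hl' : l ⊆ Q.head := fun u hu => hl (List.mem_append_left _ hu)
    have ht : t ∈ Q.head := hl (List.mem_append_right _ (List.mem_singleton_self t))
    simp only [stage_append_singleton, extend, List.mem_filter, List.mem_flatMap, List.mem_map,
      ih hl']
    constructor
    · rintro ⟨⟨_, ⟨θ₀, h₀, rfl⟩, v, hv, rfl⟩, hc⟩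
      have hdom : ∀ x, Term.var x ∈ Q.head → D.dom ≠ [] := fun x hx =>
        List.ne_nil_of_mem (h₀.1 x (Query.mem_vars.2 (.inl hx)))
      have hbase : ∀ x w, (Term.var x, w) ∈ graph θ₀ l ++ [(t, v)] → w ∈ D.dom := by
        intro x w hw
        rcases List.mem_append.1 hw with hw | hw
        · obtain ⟨u, hu, e⟩ := List.mem_map.1 hw
          obtain ⟨rfl, rfl⟩ := Prod.mk.inj e
          exact h₀.1 x (Query.mem_vars.2 (.inl (hl' hu)))
        · obtain ⟨rfl, rfl⟩ := Prod.mk.inj (List.mem_singleton.1 hw)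
          exact mem_candidates_var.1 hv
      obtain ⟨θ, hθ, hb⟩ := exists_isSolution h hc hbase hdom
      refine ⟨θ, hθ, ?_⟩
      rw [graph_append_singleton, show t.subst θ = v from hb (t, v) (by simp)]
      congr 1
      refine List.map_congr_left fun u hu => ?_
      rw [show u.subst θ = u.subst θ₀ from
        hb (u, u.subst θ₀) (List.mem_append_left _ (List.mem_map.2 ⟨u, hu, rfl⟩))]
    · rintro ⟨θ, hθ, rfl⟩
      refine ⟨⟨_, ⟨θ, hθ, rfl⟩, _, subst_mem_candidates hθ ht, (graph_append_singleton θ l t).symm⟩,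
        consistent_of_solution hθ.2 ?_ _⟩
      intro q hq
      obtain ⟨u, -, rfl⟩ := List.mem_map.1 hq
      rfl

theorem nodup_stage {n : ℕ} {Q : Query} {D : Database} (l : List Term) :
    (stage n Q D l).Nodup := by
  induction l using List.reverseRecOn with
  | nil =>
    rw [stage, List.foldl_nil, start]
    cases (consistent n (relations D.facts Q.body) [] &&
      ((Q.head.all fun t => t.isConst) || !D.dom.isEmpty)) <;> simp
  | append_singleton l t ih =>
    rw [stage_append_singleton]
    refine List.Nodup.filter _ (List.nodup_flatMap.2 ⟨fun b _ => ?_, ?_⟩)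
    · refine (nodup_candidates _ _).map fun v w e => ?_
      simpa using e
    -- Extensions of different bindings differ, since removing the last entry recovers the binding
    -- that was extended.
    · refine ih.imp_of_mem fun {b b'} _ _ hne => ?_
      intro c hc hc'
      obtain ⟨v, -, rfl⟩ := List.mem_map.1 hc
      obtain ⟨w, -, e⟩ := List.mem_map.1 hc'
      exact hne (List.append_inj_left' e rfl).symm

theorem solve_eq (n : ℕ) (Q : Query) (D : Database) :
    solve n Q D = (stage n Q D Q.head).map fun b => b.map fun p => p.2 := rfl

theorem graph_map_snd (θ : Word → Word) (l : List Term) :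
    ((graph θ l).map fun p => p.2) = l.map (Term.subst θ) := by
  simp [graph]

theorem mem_solve {Q : Query} {D : Database} {n : ℕ} (h : Q.hypertreeWidth ≤ (n : ℕ∞))
    (t : List Word) : t ∈ solve (n + 1) Q D ↔ t ∈ Q.answer D := by
  simp only [solve_eq, List.mem_map, mem_stage h Q.head (List.Subset.refl _), Query.answer,
    Set.mem_ofPred_eq, IsSolution, Query.atoms, List.mem_toFinset]
  constructor
  · rintro ⟨_, ⟨θ, hθ, rfl⟩, rfl⟩
    exact ⟨θ, hθ.1, hθ.2, graph_map_snd θ _⟩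
  · rintro ⟨θ, h₁, h₂, rfl⟩
    exact ⟨_, ⟨θ, ⟨h₁, h₂⟩, rfl⟩, graph_map_snd θ _⟩

/-- All members of the last stage bind the same list of terms, so forgetting the terms identifies no
two of them. -/
theorem nodup_solve {Q : Query} {D : Database} {n : ℕ} (h : Q.hypertreeWidth ≤ (n : ℕ∞)) :
    (solve (n + 1) Q D).Nodup := by
  rw [solve_eq]
  refine (nodup_stage Q.head).map_on fun b hb b' hb' e => ?_
  obtain ⟨θ, -, rfl⟩ := (mem_stage h _ (List.Subset.refl _) b).1 hb
  obtain ⟨θ', -, rfl⟩ := (mem_stage h _ (List.Subset.refl _) b').1 hb'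
  rw [graph_map_snd, graph_map_snd] at e
  refine List.map_congr_left fun t ht => ?_
  rw [List.map_inj_left.1 e t ht]

/-- Truncation maps the last stage onto every earlier one, because each partial binding comes from a
solution, and earlier stages have no repetitions. -/
theorem length_stage_le {Q : Query} {D : Database} {n : ℕ} (h : Q.hypertreeWidth ≤ (n : ℕ∞))
    {l : List Term} (hl : l <+: Q.head) :
    (stage (n + 1) Q D l).length ≤ (solve (n + 1) Q D).length := by
  rw [solve_eq, List.length_map,
    ← List.length_map (fun b : Bindings => b.take l.length) (as := stage (n + 1) Q D Q.head)]
  refine ((nodup_stage l).subperm fun b hb => ?_).length_le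
  obtain ⟨θ, hθ, rfl⟩ := (mem_stage h l hl.subset b).1 hb
  refine List.mem_map.2 ⟨graph θ Q.head,
    (mem_stage h _ (List.Subset.refl _) _).2 ⟨θ, hθ, rfl⟩, ?_⟩
  obtain ⟨m, hm⟩ := hl
  rw [← hm]
  simp [graph]

theorem weight_subst_le {Q : Query} {D : Database} {θ : Word → Word} (hθ : IsSolution Q D θ)
    {t : Term} (ht : t ∈ Q.head) : weight (t.subst θ) ≤ weight Q.head + weight D.dom := by
  cases t with
  | const c =>
    have h₁ := weight_add_two_le ht
    have h₂ : weight (Term.const c) = weight c + 1 := rfl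
    change weight c ≤ _
    omega
  | var x =>
    have h₁ := weight_add_two_le (hθ.1 x (Query.mem_vars.2 (.inl ht)))
    change weight (θ x) ≤ _
    omega

theorem weight_stage_le {Q : Query} {D : Database} {n : ℕ} (h : Q.hypertreeWidth ≤ (n : ℕ∞))
    {l : List Term} (hl : l <+: Q.head) :
    weight (stage (n + 1) Q D l) ≤ weight (solve (n + 1) Q D) *
      (weight Q.head * (2 * weight Q.head + weight D.dom + 4) + 2) := by
  refine (weight_le_mul (n := weight Q.head * (2 * weight Q.head + weight D.dom + 4))
    fun b hb => ?_).trans (Nat.mul_le_mul_right _ ?_)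
  · obtain ⟨θ, hθ, rfl⟩ := (mem_stage h l hl.subset b).1 hb
    refine (weight_le_mul (n := 2 * weight Q.head + weight D.dom + 2) fun q hq => ?_).trans
      (Nat.mul_le_mul_right _ ?_)
    · obtain ⟨t, ht, rfl⟩ := List.mem_map.1 hq
      have h₁ := weight_add_two_le (hl.subset ht)
      have h₂ := weight_subst_le hθ (hl.subset ht)
      rw [weight_prod]
      dsimp only
      omega
    · have h₁ := two_mul_length_le Q.head
      have h₂ := hl.length_le
      rw [graph, List.length_map]
      omega
  -- The number of partial bindings is at most the number of answer tuples, hence at most the weight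
  -- of the output.
  · have h₁ := length_stage_le (D := D) h hl
    have h₂ := two_mul_length_le (solve (n + 1) Q D)
    omega

/-! ### Encodings -/

theorem encodeWord_eq (w : Word) : encodeWord w = enclose (toData w).enc := by
  refine congrArg enclose ?_
  induction w with
  | nil => rfl
  | cons b w ih => exact congrArg (Γ'.bit b :: ·) ih

theorem encodeList_eq {α : Type} [Coded α] {f : α → List Γ'}
    (hf : ∀ a, f a = enclose (toData a).enc) (l : List α) :
    encodeList f l = enclose (toData l).enc := by
  refine congrArg enclose ?_
  induction l with
  | nil => rfl
  | cons a l ih =>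
    rw [List.flatMap_cons, ih, hf]
    simp [enclose, toData, Data.enc]

theorem encodeTerm_eq (t : Term) : encodeTerm t = enclose (toData t).enc := by
  cases t <;> exact encodeWord_eq _

theorem encodeAtom_eq (A : Atom) : encodeAtom A = enclose (toData A).enc := by
  rw [encodeAtom, encodeWord_eq, encodeList_eq encodeTerm_eq]
  simp [enclose, toData, Data.enc]

theorem encodeFact_eq (f : Fact) : encodeFact f = enclose (toData f).enc := by
  rw [encodeFact, encodeWord_eq, encodeList_eq encodeWord_eq]
  simp [enclose, toData, Data.enc]

/-- The components of an instance. -/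
abbrev Instance : Type :=
  ((List Term × List Atom × Unit) × (List Fact × List Word × Unit) × Unit) × Unit

/-- The components of the instance that consists of `Q` and `D`. -/
def instanceOf (Q : Query) (D : Database) : Instance :=
  (((Q.head, Q.body, ()), (D.facts, D.dom, ()), ()), ())

theorem encodeInstance_eq (Q : Query) (D : Database) :
    encodeInstance Q D = (toData (instanceOf Q D)).enc := by
  rw [encodeInstance, encodeQuery, encodeDatabase, encodeList_eq encodeTerm_eq,
    encodeList_eq encodeAtom_eq, encodeList_eq encodeFact_eq, encodeList_eq encodeWord_eq]
  simp [enclose, toData, Data.enc, instanceOf]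

theorem encodeRelation_eq (L : List (List Word)) :
    encodeRelation L = (toData (L, ())).enc := by
  rw [encodeRelation, encodeList_eq (encodeList_eq encodeWord_eq)]
  simp [enclose, toData, Data.enc]

/-- Types for which the weight of an element is the length of its encoding. -/
class Exact (α : Type) [Coded α] : Prop where
  weight_eq : ∀ a : α, weight a = (toData a).size

instance : Exact Unit := ⟨fun _ => rfl⟩

instance {α β : Type} [Coded α] [Coded β] [Exact α] [Exact β] : Exact (α × β) :=
  ⟨fun x => by
    rw [weight_prod, Exact.weight_eq x.1, Exact.weight_eq x.2]
    exact (Data.size_node _ _).symm⟩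

instance {α : Type} [Coded α] [Exact α] : Exact (List α) := by
  refine ⟨fun l => ?_⟩
  induction l with
  | nil => rfl
  | cons a l ih =>
    rw [weight_cons, ih, Exact.weight_eq a]
    have h : toData (a :: l) = (toData a).node (toData l) := rfl
    rw [h, Data.size_node]
    omega

instance : Exact (List Bool) := by
  refine ⟨fun w => ?_⟩
  induction w with
  | nil => rfl
  | cons b w ih => exact congrArg (· + 1) ih

instance : Exact Term := ⟨fun t => congrArg (· + 1) (Exact.weight_eq t.word)⟩

instance : Exact Atom := ⟨fun A => Exact.weight_eq (A.rel, A.args, ())⟩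

instance : Exact Fact := ⟨fun f => Exact.weight_eq (f.rel, f.args, ())⟩

/-! ### The main theorem -/

/-- The instances in which the query has hypertree width at most `k`. -/
abbrev BoundedInstance (k : ℕ) : Type :=
  {x : Query × Database // x.1.hypertreeWidth ≤ (k : ℕ∞)}

/-- The running time on an instance is measured in the lengths of the input and the output. -/
instance (k : ℕ) : Coded (BoundedInstance k) where
  toData x := toData (instanceOf x.1.1 x.1.2)
  weight x := weight (instanceOf x.1.1 x.1.2) + weight (solve (k + 1) x.1.1 x.1.2, ())
  size_le _ := (Coded.size_le _).trans (Nat.le_add_right _ _)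

/-- The weight of a bounded instance includes that of its output, so `weight_stage_le` becomes the
growth bound required for the fold over the head. -/
theorem polyTime_solve (k : ℕ) :
    PolyTime fun x : BoundedInstance k => (solve (k + 1) x.1.1 x.1.2, ()) := by
  have hx : PolyTime fun x : BoundedInstance k => instanceOf x.1.1 x.1.2 :=
    PolyTime.id.recode (fun _ => rfl) fun _ => Nat.le_add_right _ _
  have hhead : PolyTime fun x : BoundedInstance k => x.1.1.head :=
    .comp (g := fun y : Instance => y.1.1.1) (.comp .fst (.comp .fst .fst)) hx
  have hbody : PolyTime fun x : BoundedInstance k => x.1.1.body :=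
    .comp (g := fun y : Instance => y.1.1.2.1) (.comp .fst (.comp .snd (.comp .fst .fst))) hx
  have hfacts : PolyTime fun x : BoundedInstance k => x.1.2.facts :=
    .comp (g := fun y : Instance => y.1.2.1.1) (.comp .fst (.comp .fst (.comp .snd .fst))) hx
  have hdom : PolyTime fun x : BoundedInstance k => x.1.2.dom :=
    .comp (g := fun y : Instance => y.1.2.1.2.1)
      (.comp .fst (.comp .snd (.comp .fst (.comp .snd .fst)))) hx
  have hrel := hfacts.relations hbody
  refine .pair (.map (.foldl
    (f := fun (x : BoundedInstance k) =>
      extend (k + 1) (relations x.1.2.facts x.1.1.body) x.1.2.dom)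
    hhead (hrel.start hdom hhead (k + 1)) ?_ (.X * (.X * (3 * .X + 4) + 2)) fun x l hl => ?_)
    (.map .fst (.comp .snd .fst))) (.const ())
  · exact .extend (hrel.comp (.comp .fst .snd)) (hdom.comp (.comp .fst .snd))
      (.comp .snd .snd) .fst (k + 1)
  -- The weights of the output, the head and the universe are each at most the weight of the
  -- instance, the variable of the bounding polynomial.
  · refine (weight_stage_le x.2 hl).trans ?_
    have h : weight x = weight (instanceOf x.1.1 x.1.2) +
      weight (solve (k + 1) x.1.1 x.1.2, ()) := rfl
    simp only [instanceOf, weight_prod] at h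
    simp only [Polynomial.eval_add, Polynomial.eval_mul, Polynomial.eval_X, Polynomial.eval_ofNat]
    gcongr <;> omega

end ConjQuery

theorem mainTheorem8 (k : ℕ) :
    ∃ (M : Turing.TM2ComputableAux Computability.Γ' Computability.Γ') (p : Polynomial ℕ),
      ∀ (Q : ConjQuery.Query) (D : ConjQuery.Database), Q.hypertreeWidth ≤ (k : ℕ∞) →
        ∃ L : List (List ConjQuery.Word),
          L.Nodup ∧ (∀ t, t ∈ L ↔ t ∈ Q.answer D) ∧
          ConjQuery.OutputsWithin M (ConjQuery.encodeInstance Q D) (ConjQuery.encodeRelation L)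
            (p.eval ((ConjQuery.encodeInstance Q D).length +
              (ConjQuery.encodeRelation L).length)) := by
  obtain ⟨P, p, hP⟩ := ConjQuery.polyTime_solve k
  -- The additional step is the one in which the machine halts.
  refine ⟨P.machine, p + 1, fun Q D h => ⟨ConjQuery.solve (k + 1) Q D, ConjQuery.nodup_solve h,
    ConjQuery.mem_solve h, ?_⟩⟩
  have hexec := ((hP ⟨(Q, D), h⟩).2 []).outputsWithin
  rw [ConjQuery.encodeInstance_eq, ConjQuery.encodeRelation_eq, Polynomial.eval_add,
    Polynomial.eval_one]
  have hw : ConjQuery.Coded.weight (⟨(Q, D), h⟩ : ConjQuery.BoundedInstance k) =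
      (ConjQuery.Coded.toData (ConjQuery.instanceOf Q D)).size +
      (ConjQuery.Coded.toData (ConjQuery.solve (k + 1) Q D, ())).size := by
    rw [← ConjQuery.Exact.weight_eq, ← ConjQuery.Exact.weight_eq]
    rfl
  rw [hw] at hexec
  exact hexec
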